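/- Let Vertex Separator Reconfiguration be the following decision problem. An instance consists of a finite simple graph $G$, two distinct non-adjacent vertices $s,t\in V(G)$, and two $st$-separators $S_a,S_b$ of $G$, where an $st$-separator is a set $S\subseteq V(G)\setminus\{s,t\}$ such that $G-S$ contains no path between $s$ and $t$. The question is whether there is a sequence of $st$-separators $S_a=S_1,S_2,\dots,S_\ell=S_b$ ($\ell\ge 1$) in which $S_i$ and $S_{i+1}$ are adjacent for all $1\le i<\ell$. Under the rule TJ (token jumping), $S$ and $T$ are adjacent if $|S|=|T|$ and $|S\setminus T|=|T\setminus S|=1$. Under the rule $k$-TAR (token addition/removal), where $k\in\mathbb N$ is also part of the instance, $S$ and $T$ are adjacent if $|(S\setminus T)\cup(T\setminus S)|=1$ and $\max(|S|,|T|)\le k$. A graph is chordal if each of its cycles of length at least $4$ has a chord. Theorem. Restricted to instances in which $G$ is chordal, Vertex Separator Reconfiguration can be solved in polynomial time under TJ, and it can be solved in polynomial time under TAR. That is, for each of the two rules there are an algorithm and a polynomial $p$ such that, for every instance with $G$ a chordal graph on $n$ vertices (given by its adjacency matrix, with $S_a$, $S_b$ given by their indicator vectors and, under TAR, $k$ given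 as a number), the algorithm halts after at most $p(n)$ steps and answers correctly whether $S_a$ can be reconfigured into $S_b$. Here an algorithm is a program of a random access machine with natural-number registers and arrays, whose unit-cost operations are literals, register access, indirectly addressed array access, addition, truncated subtraction, assignment and zero tests for branches and loops (there is no multiplication). -/

import Mathlib

namespace VSR

/-! ## Machine model: random access machine with a step count

A machine has registers and arrays (all indexed by natural numbers) that hold natural numbers.
Its programs are finite pieces of syntax, with literals, addition, truncated subtraction and
indirect addressing, but without multiplication or shifts. Every evaluated literal, register access,
array access, arithmetic operation and every executed instruction costs one step, so that polynomial
time for this machine is polynomial time for Turing machines. -/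

/-- The memory of the machine: `reg x` is the content of register `x`,
and `arr a i` is the content of cell `i` of array `a`. -/
structure State where
  reg : ℕ → ℕ
  arr : ℕ → ℕ → ℕ

/-- Arithmetic expressions. -/
inductive Expr where
  | lit (m : ℕ)
  | reg (x : ℕ)
  | read (a : ℕ) (i : Expr)
  | add (e f : Expr)
  | sub (e f : Expr)

/-- The value of an expression; subtraction is truncated at `0`. -/
def Expr.eval (σ : State) : Expr → ℕ
  | .lit m => m
  | .reg x => σ.reg x
  | .read a i => σ.arr a (i.eval σ)
  | .add e f => e.eval σ + f.eval σ
  | .sub e f => e.eval σ - f.eval σ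

/-- The number of steps needed to evaluate an expression. -/
def Expr.cost : Expr → ℕ
  | .lit _ => 1
  | .reg _ => 1
  | .read _ i => i.cost + 1
  | .add e f => e.cost + f.cost + 1
  | .sub e f => e.cost + f.cost + 1

/-- Programs. A test `b` succeeds if its value is not `0`. -/
inductive Prog where
  /-- put the value of `e` into register `x` -/
  | assign (x : ℕ) (e : Expr)
  /-- put the value of `e` into the cell of array `a` whose index is the value of `i` -/
  | store (a : ℕ) (i e : Expr)
  /-- run `P`, then `Q` -/
  | seq (P Q : Prog)
  /-- run `P` if the test `b` succeeds, else run `Q` -/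
  | ite (b : Expr) (P Q : Prog)
  /-- run `P` as long as the test `b` succeeds -/
  | loop (b : Expr) (P : Prog)

/-- The memory after register `x` has received the value `m`. -/
def State.setReg (σ : State) (x m : ℕ) : State :=
  { σ with reg := Function.update σ.reg x m }

/-- The memory after cell `i` of array `a` has received the value `m`. -/
def State.setArr (σ : State) (a i m : ℕ) : State :=
  { σ with arr := Function.update σ.arr a (Function.update (σ.arr a) i m) }

/-- `Runs P σ τ c`: the program `P`, started with memory `σ`, halts after exactly `c` steps with
memory `τ`. -/
inductive Runs : Prog → State → State → ℕ → Prop where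
  | assign (σ : State) (x : ℕ) (e : Expr) :
      Runs (.assign x e) σ (σ.setReg x (e.eval σ)) (e.cost + 1)
  | store (σ : State) (a : ℕ) (i e : Expr) :
      Runs (.store a i e) σ (σ.setArr a (i.eval σ) (e.eval σ)) (i.cost + e.cost + 1)
  | seq {P Q : Prog} {σ τ υ : State} {c d : ℕ} (hP : Runs P σ τ c) (hQ : Runs Q τ υ d) :
      Runs (.seq P Q) σ υ (c + d)
  | ite_true {b : Expr} {P Q : Prog} {σ τ : State} {c : ℕ} (hb : b.eval σ ≠ 0)
      (hP : Runs P σ τ c) : Runs (.ite b P Q) σ τ (b.cost + 1 + c)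
  | ite_false {b : Expr} {P Q : Prog} {σ τ : State} {c : ℕ} (hb : b.eval σ = 0)
      (hQ : Runs Q σ τ c) : Runs (.ite b P Q) σ τ (b.cost + 1 + c)
  | loop_true {b : Expr} {P : Prog} {σ τ υ : State} {c d : ℕ} (hb : b.eval σ ≠ 0)
      (hP : Runs P σ τ c) (hL : Runs (.loop b P) τ υ d) :
      Runs (.loop b P) σ υ (b.cost + 1 + c + d)
  | loop_false {b : Expr} {P : Prog} {σ : State} (hb : b.eval σ = 0) :
      Runs (.loop b P) σ σ (b.cost + 1)

/-- The decision problem with instances `ι`, where the instance `I` has size `size I`, is presented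
to the machine as the initial memory `input I`, and has the answer YES if and only if `yes I`, is
solvable in polynomial time: one program halts on every instance within a number of steps that is
bounded by one polynomial in the size, with `1` in register `0` if the answer is YES, and with `0`
in register `0` if it is NO. -/
def SolvableInPolyTime {ι : Type} (size : ι → ℕ) (input : ι → State) (yes : ι → Prop) : Prop :=
  ∃ (P : Prog) (p : Polynomial ℕ), ∀ I : ι, ∃ (τ : State) (c : ℕ),
    Runs P (input I) τ c ∧ c ≤ p.eval (size I) ∧
      ((yes I ∧ τ.reg 0 = 1) ∨ (¬ yes I ∧ τ.reg 0 = 0))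

/-! ## Chordal graphs, separators, reconfiguration -/

/-- A graph is chordal if every cycle of length at least four has a chord, that is, an edge that
joins two vertices of the cycle and is not an edge of the cycle. -/
def IsChordal {V : Type*} (G : SimpleGraph V) : Prop :=
  ∀ (v : V) (c : G.Walk v v), c.IsCycle → 4 ≤ c.length →
    ∃ x ∈ c.support, ∃ y ∈ c.support, G.Adj x y ∧ s(x, y) ∉ c.edges

/-- `S` is an `st`-separator of `G`: it avoids `s` and `t`, and `G - S` has no path from `s` to
`t`. (If there is such an `S`, then `s` and `t` are distinct and not adjacent.) -/
def IsSeparator {V : Type*} (G : SimpleGraph V) (s t : V) (S : Finset V) : Prop :=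
  ∃ (hs : s ∉ S) (ht : t ∉ S), ¬ (G.induce {v | v ∉ S}).Reachable ⟨s, hs⟩ ⟨t, ht⟩

/-- Adjacency of token sets under token jumping. -/
def TJAdj {V : Type*} [DecidableEq V] (S T : Finset V) : Prop :=
  S.card = T.card ∧ (S \ T).card = 1 ∧ (T \ S).card = 1

/-- Adjacency of token sets under token addition/removal with the bound `k`. -/
def TARAdj {V : Type*} [DecidableEq V] (k : ℕ) (S T : Finset V) : Prop :=
  (symmDiff S T).card = 1 ∧ max S.card T.card ≤ k

/-- For `st`-separators `A` and `B`: there is a sequence of `st`-separators from `A` to `B` in which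
any two consecutive ones are related by `adj`. -/
def Reconfigurable {V : Type*} (G : SimpleGraph V) (s t : V)
    (adj : Finset V → Finset V → Prop) (A B : Finset V) : Prop :=
  Relation.ReflTransGen (fun S T => IsSeparator G s t S ∧ IsSeparator G s t T ∧ adj S T) A B

/-! ## The problem and its instances -/

/-- An instance `(G, s, t, S_a, S_b)`: a finite simple graph, two distinct non-adjacent vertices,
and two separators of these vertices. -/
structure Instance where
  n : ℕ
  graph : SimpleGraph (Fin n)
  s : Fin n
  t : Fin n
  source : Finset (Fin n)
  target : Finset (Fin n)
  ne : s ≠ t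
  not_adj : ¬ graph.Adj s t
  source_sep : IsSeparator graph s t source
  target_sep : IsSeparator graph s t target

/-- The instances whose graph is chordal. -/
def ChordalInstance : Type := {I : Instance // IsChordal I.graph}

/-- The answer under token jumping is YES. -/
def Instance.TJ (I : Instance) : Prop :=
  Reconfigurable I.graph I.s I.t TJAdj I.source I.target

/-- The answer under token addition/removal with the bound `k` is YES. -/
def Instance.TAR (I : Instance) (k : ℕ) : Prop :=
  Reconfigurable I.graph I.s I.t (TARAdj k) I.source I.target

open Classical in
/-- The `0`-`1` indicator array of a set of vertices. -/
noncomputable def setArray {n : ℕ} (S : Finset (Fin n)) (a : ℕ) : ℕ :=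
  if ∃ v ∈ S, a = (v : ℕ) then 1 else 0

open Classical in
/-- The adjacency matrix, stored row by row. -/
noncomputable def graphArray {n : ℕ} (G : SimpleGraph (Fin n)) (a : ℕ) : ℕ :=
  if ∃ u v : Fin n, G.Adj u v ∧ a = (u : ℕ) * n + (v : ℕ) then 1 else 0

/-- The initial memory for the instance `I` with the number `k`: registers `0`, `1`, `2`, `3` hold
`n`, `s`, `t`, `k`; array `0` holds the adjacency matrix, arrays `1` and `2` hold the source and the
target; everything else is `0`. -/
noncomputable def Instance.input (I : Instance) (k : ℕ) : State where
  reg x := match x with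
    | 0 => I.n
    | 1 => (I.s : ℕ)
    | 2 => (I.t : ℕ)
    | 3 => k
    | _ => 0
  arr a := match a with
    | 0 => graphArray I.graph
    | 1 => setArray I.source
    | 2 => setArray I.target
    | _ => fun _ => 0

end VSR

/-! A chordal graph has few minimal separators. Let `T` be an inclusion-minimal `st`-separator. Each
vertex of `T` has a neighbor in the component of `s` and one in the component of `t` of `G - T`. Two
non-adjacent vertices of `T` would be joined by an induced path through each of these components,
and the two paths would form a chordless cycle of length at least four (`IsChordal.adj_of_linked`);
so `T` is a clique. A vertex `x` of the component of `s` with the most neighbors in `T` is adjacent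
to all of `T` (`IsChordal.exists_dominating`), and so is some `y` in the component of `t`. A common
neighbor of `x` and `y` outside `T` would connect the components, hence `T = N(x) ∩ N(y)`. So every
separator contains one of at most `n * n` separators that are common neighborhoods
(`IsChordal.exists_commonNeighbors`).

Consider the graph `NodeAdj` on these common neighborhoods together with source and target: its
nodes are the separators of size at most `K`, and two of them are joined if their union has size at
most `M`. A reconfiguration sequence projects to a path there by choosing a member of the family
inside each separator. Conversely, an edge lifts to a sequence: under TAR, with `K = M = k`, the
tokens grow to the union and then shrink; under TJ, with `K` the number of tokens and `M = K + 1`,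
the members are padded to `K` tokens, and padding can be moved freely. This gives
`reconfigurable_tar_iff` and `reconfigurable_tj_iff`.

It remains to search a graph with `n * n + 2` nodes. The program is written in `Code`, where every
loop is counted, so that its effect is a function and its running time a polynomial in the loop
bounds. These bounds depend on `n` only; `k` is merely compared with sizes. Truth values are `0` and
`1`: on them `a + b - 1` is conjunction and `1 - (1 - (a + b))` is disjunction. -/

namespace VSR

/-! ### Minimal separators of chordal graphs -/

section Graph

variable {V : Type*} {G : SimpleGraph V}

/-- There is a walk from `x` to `y` all of whose vertices satisfy `P`. -/
def Linked (G : SimpleGraph V) (P : V → Prop) (x y : V) : Prop :=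
  ∃ p : G.Walk x y, ∀ z ∈ p.support, P z

theorem Linked.refl {P : V → Prop} {x : V} (h : P x) : Linked G P x x :=
  ⟨.nil, by simpa using h⟩

theorem Linked.symm {P : V → Prop} {x y : V} (h : Linked G P x y) : Linked G P y x := by
  obtain ⟨p, hp⟩ := h
  exact ⟨p.reverse, by simpa using hp⟩

theorem Linked.trans {P : V → Prop} {x y z : V} (h : Linked G P x y) (h' : Linked G P y z) :
    Linked G P x z := by
  obtain ⟨p, hp⟩ := h
  obtain ⟨q, hq⟩ := h'
  refine ⟨p.append q, fun w hw => ?_⟩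
  rw [SimpleGraph.Walk.mem_support_append_iff] at hw
  exact hw.elim (hp w) (hq w)

theorem Linked.of_adj {P : V → Prop} {x y : V} (h : G.Adj x y) (hx : P x) (hy : P y) :
    Linked G P x y :=
  ⟨.cons h .nil, by simp [hx, hy]⟩

theorem Linked.mono {P Q : V → Prop} (hPQ : ∀ x, P x → Q x) {x y : V} (h : Linked G P x y) :
    Linked G Q x y := by
  obtain ⟨p, hp⟩ := h
  exact ⟨p, fun z hz => hPQ z (hp z hz)⟩

theorem Linked.left {P : V → Prop} {x y : V} (h : Linked G P x y) : P x := by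
  obtain ⟨p, hp⟩ := h
  exact hp _ p.start_mem_support

theorem Linked.right {P : V → Prop} {x y : V} (h : Linked G P x y) : P y := h.symm.left

/-- The set of vertices linked to `x` is connected. -/
theorem Linked.within {P : V → Prop} {x y z : V} (hy : Linked G P x y) (hz : Linked G P x z) :
    Linked G (Linked G P x) y z := by
  classical
  have key : ∀ w, Linked G P x w → Linked G (Linked G P x) x w := by
    rintro w ⟨p, hp⟩
    exact ⟨p, fun u hu => ⟨p.takeUntil u hu,
      fun v hv => hp v (p.support_takeUntil_subset_support hu hv)⟩⟩
  exact (key y hy).symm.trans (key z hz)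

/-- On a walk that leaves `¬ Q` there is a first vertex that satisfies `Q`. -/
theorem Linked.exists_first {P Q : V → Prop} {x y : V} (h : Linked G P x y) (hx : ¬ Q x)
    (hy : Q y) :
    ∃ d w, Linked G (fun z => P z ∧ ¬ Q z) x d ∧ G.Adj d w ∧ P w ∧ Q w := by
  obtain ⟨p, hp⟩ := h
  induction p with
  | nil => exact absurd hy hx
  | @cons x x' y hadj p ih =>
    have hPx : P x := hp x (by simp)
    have hp' : ∀ z ∈ p.support, P z := fun z hz => hp z (by simp [hz])
    by_cases hQ : Q x'
    · exact ⟨x, x', .refl ⟨hPx, hx⟩, hadj, hp' _ p.start_mem_support, hQ⟩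
    · obtain ⟨d, w, hd, h⟩ := ih hQ hy hp'
      exact ⟨d, w, (Linked.of_adj hadj ⟨hPx, hx⟩ hd.left).trans hd, h⟩

/-- Each step tests only the vertex it enters, so the start needs its own hypothesis. This is the
form of reachability that the program computes. -/
theorem linked_iff_reflTransGen {P : V → Prop} {x y : V} (hx : P x) :
    Linked G P x y ↔ Relation.ReflTransGen (fun u v => G.Adj u v ∧ P v) x y := by
  constructor
  · rintro ⟨p, hp⟩
    induction p with
    | nil => exact .refl
    | @cons x x' y hadj p ih =>
      have hp' : ∀ z ∈ p.support, P z := fun z hz => hp z (by simp [hz])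
      have hx' := hp' _ p.start_mem_support
      exact .head ⟨hadj, hx'⟩ (ih hx' hp')
  · intro h
    induction h with
    | refl => exact .refl hx
    | tail _ h ih => exact ih.trans (.of_adj h.1 ih.right h.2)

/-- Walks of the induced subgraph are replaced by walks of `G` that avoid `S`, which can be compared
for different `S`. -/
theorem isSeparator_iff {s t : V} {S : Finset V} :
    IsSeparator G s t S ↔ s ∉ S ∧ t ∉ S ∧ ¬ Linked G (· ∉ S) s t := by
  unfold IsSeparator
  constructor
  · rintro ⟨hs, ht, h⟩
    refine ⟨hs, ht, fun ⟨p, hp⟩ => h ?_⟩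
    exact ⟨p.induce {v | v ∉ S} hp⟩
  · rintro ⟨hs, ht, h⟩
    refine ⟨hs, ht, fun ⟨p⟩ => h ?_⟩
    refine ⟨p.map (SimpleGraph.Embedding.induce {v | v ∉ S}).toHom, fun z hz => ?_⟩
    obtain ⟨w, -, rfl⟩ := List.mem_map.1 ((SimpleGraph.Walk.support_map _ p) ▸ hz)
    exact w.2

theorem IsSeparator.symm {s t : V} {S : Finset V} (h : IsSeparator G s t S) :
    IsSeparator G t s S := by
  rw [isSeparator_iff] at h ⊢
  exact ⟨h.2.1, h.1, fun h' => h.2.2 h'.symm⟩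

theorem IsSeparator.mono {s t : V} {S T : Finset V} (h : IsSeparator G s t S) (hST : S ⊆ T)
    (hs : s ∉ T) (ht : t ∉ T) : IsSeparator G s t T := by
  rw [isSeparator_iff] at h ⊢
  exact ⟨hs, ht, fun h' => h.2.2 (h'.mono fun x hx hxS => hx (hST hxS))⟩

theorem mk_getVert_mem_edges {x y : V} (p : G.Walk x y) {i : ℕ} (hi : i + 1 ≤ p.length) :
    s(p.getVert i, p.getVert (i + 1)) ∈ p.edges := by
  induction p generalizing i with
  | nil => simp at hi
  | cons h p ih =>
    cases i with
    | zero => simp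
    | succ i =>
      rw [SimpleGraph.Walk.length_cons] at hi
      simpa using .inr (ih (by omega))

/-- A shortest walk inside a vertex set is an induced path. -/
theorem Linked.exists_chordless {P : V → Prop} {x y : V} (h : Linked G P x y) :
    ∃ p : G.Walk x y, p.IsPath ∧ p.IsChordless ∧ ∀ z ∈ p.support, P z := by
  classical
  obtain ⟨p, hp, hmin⟩ : ∃ p : G.Walk x y, (∀ z ∈ p.support, P z) ∧
      ∀ q : G.Walk x y, (∀ z ∈ q.support, P z) → p.length ≤ q.length := by
    obtain ⟨p, hp⟩ := h
    obtain ⟨p, hp, hmin⟩ := exists_minimalFor_of_wellFoundedLT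
      (fun q : G.Walk x y => ∀ z ∈ q.support, P z) SimpleGraph.Walk.length ⟨p, hp⟩
    exact ⟨p, hp, fun q hq => (le_total p.length q.length).elim id (hmin hq)⟩
  refine ⟨p, ?_, ?_, hp⟩
  -- Bypassing repeated vertices stays inside `P`, so a shortest walk equals its bypass.
  · have := hmin p.bypass fun z hz => hp z (p.support_bypass_subset_support hz)
    rw [← p.bypass_eq_self_of_length_le_length_bypass this]
    exact p.bypass_isPath
  · rw [SimpleGraph.Walk.isChordless_iff_forall_mem_edges]
    have key : ∀ i j, i < j → j ≤ p.length → G.Adj (p.getVert i) (p.getVert j) →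
        s(p.getVert i, p.getVert j) ∈ p.edges := by
      intro i j hij hj hadj
      -- An edge between positions `i < j` gives the detour `take i`, edge, `drop j` inside `P`;
      -- minimality leaves only `j = i + 1`.
      have hlen := hmin ((p.take i).append (.cons hadj (p.drop j))) fun z hz => by
        rw [SimpleGraph.Walk.mem_support_append_iff, SimpleGraph.Walk.support_cons,
          List.mem_cons, SimpleGraph.Walk.support_take,
          SimpleGraph.Walk.drop_support_eq_support_drop_min] at hz
        rcases hz with hz | rfl | hz
        · exact hp z (List.mem_of_mem_take hz)
        · exact hp _ (p.getVert_mem_support i)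
        · exact hp z (List.mem_of_mem_drop hz)
      simp only [SimpleGraph.Walk.length_append, SimpleGraph.Walk.take_length,
        SimpleGraph.Walk.length_cons, SimpleGraph.Walk.drop_length] at hlen
      obtain rfl : j = i + 1 := by omega
      exact mk_getVert_mem_edges p hj
    intro u v hu hv hadj
    rw [SimpleGraph.Walk.mem_support_iff_exists_getVert] at hu hv
    obtain ⟨i, rfl, hi⟩ := hu
    obtain ⟨j, rfl, hj⟩ := hv
    rcases lt_trichotomy i j with h | rfl | h
    · exact key i j h hj hadj
    · exact absurd hadj G.irrefl
    · rw [Sym2.eq_swap]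
      exact key j i h hi hadj.symm

/-- In a chordal graph two non-adjacent vertices are not joined through two vertex sets without
edges between them. -/
theorem IsChordal.adj_of_linked (hG : IsChordal G) {a b : V} {A B : V → Prop} (hab : a ≠ b)
    (haA : ¬ A a) (hbA : ¬ A b) (hA : Linked G (fun z => z = a ∨ z = b ∨ A z) a b)
    (hB : Linked G (fun z => z = a ∨ z = b ∨ B z) a b)
    (hAB : ∀ x y, A x → B y → x ≠ y ∧ ¬ G.Adj x y) : G.Adj a b := by
  by_contra hadj
  -- Induced paths there and back, with interiors in `A` and in `B`. If `a` and `b` are not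
  -- adjacent, each has length at least two, and together they form a cycle of length at least four.
  obtain ⟨p, hp, hpc, hpA⟩ := hA.exists_chordless
  obtain ⟨q, hq, hqc, hqB⟩ := hB.symm.exists_chordless
  have hlen : ∀ {a b : V} (r : G.Walk a b), a ≠ b → ¬ G.Adj a b → 2 ≤ r.length := by
    intro a b r hab hadj
    by_contra! h
    have : r.length = 0 ∨ r.length = 1 := by omega
    rcases this with h | h
    · exact hab (SimpleGraph.Walk.eq_of_length_eq_zero h)
    · exact hadj (SimpleGraph.Walk.adj_of_length_eq_one h)
  have hp2 := hlen p hab hadj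
  have hq2 := hlen q hab.symm fun h => hadj h.symm
  have hdis : p.support.tail.Disjoint q.support.tail := by
    intro z hzp hzq
    have hza : z ≠ a := by
      rintro rfl
      have := hp.support_nodup
      rw [← p.cons_tail_support, List.nodup_cons] at this
      exact this.1 hzp
    have hzb : z ≠ b := by
      rintro rfl
      have := hq.support_nodup
      rw [← q.cons_tail_support, List.nodup_cons] at this
      exact this.1 hzq
    have h1 := hpA z (List.mem_of_mem_tail hzp)
    have h2 := hqB z (List.mem_of_mem_tail hzq)
    exact (hAB z z (by tauto) (by tauto)).1 rfl
  obtain ⟨x, hx, y, hy, hxy, he⟩ := hG a _ (hp.isCycle_append hq hdis (.inl hp2))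
    (by rw [SimpleGraph.Walk.length_append]; omega)
  rw [SimpleGraph.Walk.mem_support_append_iff] at hx hy
  rw [SimpleGraph.Walk.edges_append, List.mem_append, not_or] at he
  -- A chord between the two paths: since both are induced, `u` is not on `q` and `v` is not on `p`.
  -- So neither is `a` or `b`, and the chord runs between `A` and `B`.
  have hpq : ∀ u v, u ∈ p.support → v ∈ q.support → G.Adj u v → s(u, v) ∉ p.edges →
      s(u, v) ∉ q.edges → False := by
    intro u v hu hv huv hep heq
    have hu' := hpA u hu
    have hv' := hqB v hv
    have hu2 : u ∉ q.support := fun h => heq (hqc.mem_edges h hv huv)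
    have hv2 : v ∉ p.support := fun h => hep (hpc.mem_edges hu h huv)
    have h1 : u ≠ a := by rintro rfl; exact hu2 q.end_mem_support
    have h2 : u ≠ b := by rintro rfl; exact hu2 q.start_mem_support
    have h3 : v ≠ a := by rintro rfl; exact hv2 p.start_mem_support
    have h4 : v ≠ b := by rintro rfl; exact hv2 p.end_mem_support
    exact (hAB u v (by tauto) (by tauto)).2 huv
  rcases hx with hx | hx <;> rcases hy with hy | hy
  · exact he.1 (hpc.mem_edges hx hy hxy)
  · exact hpq x y hx hy hxy he.1 he.2
  · rw [Sym2.eq_swap] at he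
    exact hpq y x hy hx hxy.symm he.1 he.2
  · exact he.2 (hqc.mem_edges hx hy hxy)

/-- Produces the two connections that `IsChordal.adj_of_linked` asks for. -/
theorem Linked.of_neighbors {A : V → Prop} {a b a' b' : V} (ha : G.Adj a a') (hb : G.Adj b b')
    (h : Linked G A a' b') : Linked G (fun z => z = a ∨ z = b ∨ A z) a b := by
  have h1 := h.mono (Q := fun z => z = a ∨ z = b ∨ A z) fun z hz => .inr (.inr hz)
  exact ((Linked.of_adj ha (.inl rfl) h1.left).trans h1).trans
    (.of_adj hb.symm h1.right (.inr (.inl rfl)))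

/-- In a minimal separator every vertex has a neighbor in the component of `s`. -/
theorem exists_adj_of_minimal [DecidableEq V] {s t : V} {S : Finset V} (hS : IsSeparator G s t S)
    {v : V} (hv : v ∈ S) (hmin : ¬ IsSeparator G s t (S.erase v)) :
    ∃ w, Linked G (· ∉ S) s w ∧ G.Adj v w := by
  rw [isSeparator_iff] at hS hmin
  obtain ⟨hs, ht, hst⟩ := hS
  by_contra! hno
  have hlink : Linked G (· ∉ S.erase v) s t := by
    by_contra h
    exact hmin ⟨fun h' => hs (Finset.mem_of_mem_erase h'),
      fun h' => ht (Finset.mem_of_mem_erase h'), h⟩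
  by_cases hL : Linked G (· ∉ S) s s
  -- Putting `v` back opens a walk to `t`. The first vertex where it leaves the old component of `s`
  -- must be `v`, so its predecessor is a neighbor of `v` in that component.
  · obtain ⟨d, w, hd, hdw, hw, hw'⟩ := hlink.exists_first
      (Q := fun z => ¬ Linked G (· ∉ S) s z) (not_not.2 hL) hst
    have hd' : Linked G (· ∉ S) s d := not_not.1 hd.right.2
    by_cases hwS : w ∈ S
    · obtain rfl : w = v := by
        by_contra hne
        exact hw (Finset.mem_erase.2 ⟨hne, hwS⟩)
      exact hno d hd' hdw.symm
    · exact hw' (hd'.trans (.of_adj hdw hd'.right hwS))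
  · exact hL (.refl hs)

/-- If a clique `S` has the property that each of its vertices has a neighbor in the connected set
`C` disjoint from `S`, then in a chordal graph some vertex of `C` is adjacent to all of `S`. -/
theorem IsChordal.exists_dominating [DecidableEq V] (hG : IsChordal G) {s : V} {S : Finset V}
    (hs : s ∉ S) (hclique : ∀ u ∈ S, ∀ v ∈ S, u ≠ v → G.Adj u v)
    (hN : ∀ v ∈ S, ∃ w, Linked G (· ∉ S) s w ∧ G.Adj v w) :
    ∃ x, Linked G (· ∉ S) s x ∧ ∀ v ∈ S, G.Adj x v := by
  classical
  -- A vertex of the component with the most neighbors in `S`, found by minimizing the number of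
  -- vertices of `S` that it misses.
  obtain ⟨x, hx, hmax⟩ : ∃ x, Linked G (· ∉ S) s x ∧ ∀ y, Linked G (· ∉ S) s y →
      (S.filter (G.Adj y)).card ≤ (S.filter (G.Adj x)).card := by
    obtain ⟨x, hx, hm⟩ := exists_minimalFor_of_wellFoundedLT
      (fun x => Linked G (· ∉ S) s x) (fun x => S.card - (S.filter (G.Adj x)).card)
      ⟨s, .refl hs⟩
    refine ⟨x, hx, fun y hy => ?_⟩
    have h1 := Finset.card_filter_le S (G.Adj x)
    have h2 := Finset.card_filter_le S (G.Adj y)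
    by_contra! h
    have := hm hy (by dsimp only; omega)
    dsimp only at this
    omega
  refine ⟨x, hx, fun v hv => ?_⟩
  by_contra hxv
  obtain ⟨w, hw, hvw⟩ := hN v hv
  -- If `x` misses `v`, let `p` be the first neighbor of `v` on a walk from `x` inside the
  -- component. It will turn out to have more neighbors in `S` than `x`.
  obtain ⟨d, p, hd, hdp, hp, hvp⟩ := (hx.within hw).exists_first (Q := fun z => G.Adj v z)
    (fun h => hxv h.symm) hvw
  have hpS : p ∉ S := hp.right
  -- The vertices `p` and `u` are joined through `v`, as `S` is a clique, and through the walk back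
  -- to `x`, none of whose vertices before `p` is adjacent to `v`. Chordality makes them adjacent.
  have hall : ∀ u ∈ S, G.Adj x u → G.Adj p u := by
    intro u hu hxu
    have huv : u ≠ v := by rintro rfl; exact hxv hxu
    refine hG.adj_of_linked (A := fun z => z = v)
      (B := Linked G (fun z => Linked G (· ∉ S) s z ∧ ¬ G.Adj v z) x)
      (by rintro rfl; exact hpS hu) (by rintro rfl; exact hpS hv) huv
      (.of_neighbors hvp.symm (hclique u hu v hv huv) (.refl rfl))
      (.of_neighbors hdp.symm hxu.symm ((hd.trans hd.symm).within hd).symm) ?_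
    rintro z y rfl hy
    refine ⟨?_, hy.right.2⟩
    rintro rfl
    exact hy.right.1.right hv
  have hlt : (S.filter (G.Adj x)).card < (S.filter (G.Adj p)).card := by
    refine Finset.card_lt_card ⟨fun u hu => ?_, fun h => ?_⟩
    · rw [Finset.mem_filter] at hu ⊢
      exact ⟨hu.1, hall u hu.1 hu.2⟩
    · exact hxv (Finset.mem_filter.1 (h (Finset.mem_filter.2 ⟨hv, hvp.symm⟩))).2
  exact absurd (hmax p hp) (not_le.2 hlt)

/-- In a chordal graph every separator contains a separator that consists of all common neighbors
of two vertices. -/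
theorem IsChordal.exists_commonNeighbors [DecidableEq V] (hG : IsChordal G) {s t : V}
    {S : Finset V} (hS : IsSeparator G s t S) :
    ∃ T ⊆ S, IsSeparator G s t T ∧ ∃ x y, ∀ v, v ∈ T ↔ G.Adj x v ∧ G.Adj y v := by
  obtain ⟨T, hTS, hT⟩ := exists_minimal_le_of_wellFoundedLT (IsSeparator G s t) S hS
  refine ⟨T, hTS, hT.prop, ?_⟩
  have hTsep := isSeparator_iff.1 hT.prop
  have hmin : ∀ v ∈ T, ¬ IsSeparator G s t (T.erase v) := fun v hv h =>
    Finset.notMem_erase v T (hT.le_of_le h (Finset.erase_subset v T) hv)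
  have hNs : ∀ v ∈ T, ∃ w, Linked G (· ∉ T) s w ∧ G.Adj v w := fun v hv =>
    exists_adj_of_minimal hT.prop hv (hmin v hv)
  have hNt : ∀ v ∈ T, ∃ w, Linked G (· ∉ T) t w ∧ G.Adj v w := fun v hv =>
    exists_adj_of_minimal hT.prop.symm hv fun h => hmin v hv h.symm
  -- The components of `s` and `t` are disjoint with no edges between them, and `u` and `v` have
  -- neighbors in both.
  have hclique : ∀ u ∈ T, ∀ v ∈ T, u ≠ v → G.Adj u v := by
    intro u hu v hv huv
    obtain ⟨u₁, hu₁, hau₁⟩ := hNs u hu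
    obtain ⟨v₁, hv₁, hav₁⟩ := hNs v hv
    obtain ⟨u₂, hu₂, hau₂⟩ := hNt u hu
    obtain ⟨v₂, hv₂, hav₂⟩ := hNt v hv
    refine hG.adj_of_linked (A := Linked G (· ∉ T) s) (B := Linked G (· ∉ T) t) huv
      (fun h => h.right hu) (fun h => h.right hv) (.of_neighbors hau₁ hav₁ (hu₁.within hv₁))
      (.of_neighbors hau₂ hav₂ (hu₂.within hv₂)) fun x y hx hy => ⟨?_, fun hxy => ?_⟩
    · rintro rfl
      exact hTsep.2.2 (hx.trans hy.symm)
    · exact hTsep.2.2 ((hx.trans (.of_adj hxy hx.right hy.right)).trans hy.symm)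
  obtain ⟨x, hx, hxT⟩ := hG.exists_dominating hTsep.1 hclique hNs
  obtain ⟨y, hy, hyT⟩ := hG.exists_dominating hTsep.2.1 hclique hNt
  -- A common neighbor of `x` and `y` outside `T` would link the two components.
  refine ⟨x, y, fun v => ⟨fun hv => ⟨hxT v hv, hyT v hv⟩, fun ⟨hxv, hyv⟩ => ?_⟩⟩
  by_contra hv
  exact hTsep.2.2 (((hx.trans (.of_adj hxv hx.right hv)).trans
    (.of_adj hyv.symm hv hy.right)).trans hy.symm)

end Graph

/-! ### Reconfiguration as reachability in a family of separators -/

section Reconfiguration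

variable {V : Type*} {G : SimpleGraph V} {s t : V}

theorem Reconfigurable.trans {adj : Finset V → Finset V → Prop} {A B C : Finset V}
    (h : Reconfigurable G s t adj A B) (h' : Reconfigurable G s t adj B C) :
    Reconfigurable G s t adj A C :=
  Relation.ReflTransGen.trans h h'

theorem Reconfigurable.symm {adj : Finset V → Finset V → Prop} (hadj : ∀ S T, adj S T → adj T S)
    {A B : Finset V} (h : Reconfigurable G s t adj A B) : Reconfigurable G s t adj B A := by
  induction h with
  | refl => exact .refl
  | tail _ h ih => exact .head ⟨h.2.1, h.1, hadj _ _ h.2.2⟩ ih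

theorem Reconfigurable.single {adj : Finset V → Finset V → Prop} {A B : Finset V}
    (hA : IsSeparator G s t A) (hB : IsSeparator G s t B) (h : adj A B) :
    Reconfigurable G s t adj A B :=
  Relation.ReflTransGen.single ⟨hA, hB, h⟩

variable [DecidableEq V]

/-- Adjacency of two members of a family of vertex sets: both are separators with at most `K`
elements, and their union has at most `M` elements. -/
def NodeAdj (G : SimpleGraph V) (s t : V) (F : ℕ → Finset V) (m K M : ℕ) (i j : ℕ) : Prop :=
  (i < m ∧ IsSeparator G s t (F i) ∧ (F i).card ≤ K) ∧
    (j < m ∧ IsSeparator G s t (F j) ∧ (F j).card ≤ K) ∧ (F i ∪ F j).card ≤ M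

theorem TARAdj.symm {k : ℕ} {S T : Finset V} (h : TARAdj k S T) : TARAdj k T S := by
  unfold TARAdj at h ⊢
  rwa [symmDiff_comm, max_comm]

theorem TJAdj.symm {S T : Finset V} (h : TJAdj S T) : TJAdj T S :=
  ⟨h.1.symm, h.2.2, h.2.1⟩

theorem TARAdj.card_union_le {k : ℕ} {S T : Finset V} (h : TARAdj k S T) :
    S.card ≤ k ∧ T.card ≤ k ∧ (S ∪ T).card ≤ k := by
  obtain ⟨h1, h2⟩ := h
  have hS : S.card ≤ k := (le_max_left _ _).trans h2
  have hT : T.card ≤ k := (le_max_right _ _).trans h2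
  refine ⟨hS, hT, ?_⟩
  have h3 : (symmDiff S T).card = (S \ T).card + (T \ S).card :=
    Finset.card_union_of_disjoint disjoint_sdiff_sdiff
  have e1 := Finset.card_sdiff_add_card S T
  have e2 := Finset.card_sdiff_add_card T S
  rw [Finset.union_comm T S] at e2
  omega

theorem TJAdj.card_union {S T : Finset V} (h : TJAdj S T) : (S ∪ T).card = S.card + 1 := by
  have e2 := Finset.card_sdiff_add_card T S
  rw [Finset.union_comm T S] at e2
  have := h.2.2
  omega

/-- A reconfiguration sequence yields a path in a family that contains a subset of every
separator. -/
theorem Reconfigurable.reflTransGen_nodeAdj {adj : Finset V → Finset V → Prop} {F : ℕ → Finset V}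
    {m K M a b : ℕ} (hKM : K ≤ M)
    (hadj : ∀ S T, adj S T → S.card ≤ K → T.card ≤ K ∧ (S ∪ T).card ≤ M)
    (hF : ∀ S, IsSeparator G s t S → ∃ i < m, IsSeparator G s t (F i) ∧ F i ⊆ S)
    (ha : a < m) (hb : b < m) (hsep : IsSeparator G s t (F a)) (hK : (F a).card ≤ K)
    (h : Reconfigurable G s t adj (F a) (F b)) :
    Relation.ReflTransGen (NodeAdj G s t F m K M) a b := by
  have key : ∀ S, Reconfigurable G s t adj (F a) S → IsSeparator G s t S ∧ S.card ≤ K ∧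
      ∃ i < m, IsSeparator G s t (F i) ∧ F i ⊆ S ∧
        Relation.ReflTransGen (NodeAdj G s t F m K M) a i := by
    intro S hS
    induction hS with
    | refl => exact ⟨hsep, hK, a, ha, hsep, subset_rfl, .refl⟩
    | @tail S T _ hST ih =>
      obtain ⟨hS, hSK, i, hi, hiS, hsub, hpath⟩ := ih
      obtain ⟨hTK, hU⟩ := hadj S T hST.2.2 hSK
      obtain ⟨j, hj, hjS, hjT⟩ := hF T hST.2.1
      refine ⟨hST.2.1, hTK, j, hj, hjS, hjT, hpath.tail ⟨⟨hi, hiS, ?_⟩, ⟨hj, hjS, ?_⟩, ?_⟩⟩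
      · exact (Finset.card_le_card hsub).trans hSK
      · exact (Finset.card_le_card hjT).trans hTK
      · exact (Finset.card_le_card (Finset.union_subset_union hsub hjT)).trans hU
  obtain ⟨hbS, hbK, i, hi, hiS, hsub, hpath⟩ := key _ h
  -- The member found inside `F b` may differ from `F b`; as it is a subset, the union is `F b`
  -- itself and one more edge suffices.
  refine hpath.tail ⟨⟨hi, hiS, (Finset.card_le_card hsub).trans hbK⟩, ⟨hb, hbS, hbK⟩, ?_⟩
  rw [Finset.union_eq_right.2 hsub]
  exact hbK.trans hKM

/-- The vertices of `B` outside `A` are added one at a time; every intermediate set contains the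
separator `A` and is no larger than `B`. -/
theorem reconfigurable_tar_of_subset {k : ℕ} {A B : Finset V} (hA : IsSeparator G s t A)
    (hAB : A ⊆ B) (hs : s ∉ B) (ht : t ∉ B) (hB : B.card ≤ k) :
    Reconfigurable G s t (TARAdj k) A B := by
  induction B using Finset.strongInduction with
  | H B ih =>
    by_cases h : A = B
    · subst h
      exact .refl
    · obtain ⟨v, hvB, hvA⟩ := Finset.exists_of_ssubset (Finset.ssubset_iff_subset_ne.2 ⟨hAB, h⟩)
      have hsub : A ⊆ B.erase v := Finset.subset_erase.2 ⟨hAB, hvA⟩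
      have hs' : s ∉ B.erase v := fun h => hs (Finset.mem_of_mem_erase h)
      have ht' : t ∉ B.erase v := fun h => ht (Finset.mem_of_mem_erase h)
      have hle := (Finset.card_erase_le (a := v)).trans hB
      refine (ih _ (Finset.erase_ssubset hvB) hsub hs' ht' hle).trans
        (.single (hA.mono hsub hs' ht') (hA.mono hAB hs ht) ⟨?_, max_le hle hB⟩)
      have : symmDiff (B.erase v) B = {v} := by
        ext w
        simp only [Finset.mem_symmDiff, Finset.mem_erase, Finset.mem_singleton]
        constructor
        · tauto
        · rintro rfl
          tauto
      rw [this, Finset.card_singleton]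

/-- The sequence climbs to the union and descends again. -/
theorem NodeAdj.reconfigurable_tar {F : ℕ → Finset V} {m k i j : ℕ}
    (h : NodeAdj G s t F m k k i j) : Reconfigurable G s t (TARAdj k) (F i) (F j) := by
  obtain ⟨⟨-, hi, -⟩, ⟨-, hj, -⟩, hU⟩ := h
  have hs : s ∉ F i ∪ F j := by
    rw [Finset.mem_union, not_or]
    exact ⟨hi.choose, hj.choose⟩
  have ht : t ∉ F i ∪ F j := by
    rw [Finset.mem_union, not_or]
    exact ⟨(isSeparator_iff.1 hi).2.1, (isSeparator_iff.1 hj).2.1⟩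
  exact (reconfigurable_tar_of_subset hi Finset.subset_union_left hs ht hU).trans
    ((reconfigurable_tar_of_subset hj Finset.subset_union_right hs ht hU).symm
      fun _ _ => TARAdj.symm)

/-- Two separators of the same size that contain a common separator are reconfigurable into each
other by token jumping. -/
theorem reconfigurable_tj_of_subset {A S T : Finset V} (hA : IsSeparator G s t A) (hAS : A ⊆ S)
    (hAT : A ⊆ T) (hS : s ∉ S ∧ t ∉ S) (hT : s ∉ T ∧ t ∉ T) (hcard : S.card = T.card) :
    Reconfigurable G s t TJAdj S T := by
  induction hd : (S \ T).card generalizing S with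
  | zero =>
    rw [Finset.card_eq_zero, Finset.sdiff_eq_empty_iff_subset] at hd
    rw [Finset.eq_of_subset_of_card_le hd hcard.ge]
    exact .refl
  | succ d ih =>
    have e1 := Finset.card_sdiff_add_card S T
    have e2 := Finset.card_sdiff_add_card T S
    rw [Finset.union_comm T S] at e2
    obtain ⟨x, hx⟩ := Finset.card_pos.1 (by omega : 0 < (S \ T).card)
    obtain ⟨y, hy⟩ := Finset.card_pos.1 (by omega : 0 < (T \ S).card)
    rw [Finset.mem_sdiff] at hx hy
    have hxy : x ≠ y := by rintro rfl; exact hx.2 hy.1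
    have hyS : y ∉ S.erase x := fun h => hy.2 (Finset.mem_of_mem_erase h)
    -- The jump from `x ∈ S \ T` to `y ∈ T \ S` leaves `A` untouched because `A ⊆ T`, and it brings
    -- the set closer to `T`.
    set S' := insert y (S.erase x) with hS'
    have hc : S'.card = S.card := by
      rw [hS', Finset.card_insert_of_notMem hyS, Finset.card_erase_add_one hx.1]
    have hAS' : A ⊆ S' := (Finset.subset_erase.2 ⟨hAS, fun h => hx.2 (hAT h)⟩).trans
      (Finset.subset_insert _ _)
    have hnot : ∀ v, v ∉ S → v ∉ T → v ∉ S' := by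
      intro v hvS hvT h
      rw [hS', Finset.mem_insert] at h
      rcases h with rfl | h
      · exact hvT hy.1
      · exact hvS (Finset.mem_of_mem_erase h)
    have hS'st : s ∉ S' ∧ t ∉ S' := ⟨hnot s hS.1 hT.1, hnot t hS.2 hT.2⟩
    have hd1 : S \ S' = {x} := by
      ext v
      simp only [hS', Finset.mem_sdiff, Finset.mem_insert, Finset.mem_erase, Finset.mem_singleton]
      constructor
      · tauto
      · rintro rfl
        tauto
    have hd2 : S' \ S = {y} := by
      ext v
      simp only [hS', Finset.mem_sdiff, Finset.mem_insert, Finset.mem_erase, Finset.mem_singleton]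
      constructor
      · tauto
      · rintro rfl
        tauto
    have hd3 : S' \ T = (S \ T).erase x := by
      ext v
      simp only [hS', Finset.mem_sdiff, Finset.mem_insert, Finset.mem_erase]
      constructor
      · rintro ⟨rfl | h, h'⟩
        · exact absurd hy.1 h'
        · tauto
      · tauto
    refine (Reconfigurable.single (hA.mono hAS hS.1 hS.2) (hA.mono hAS' hS'st.1 hS'st.2)
      ⟨hc.symm, by rw [hd1, Finset.card_singleton], by rw [hd2, Finset.card_singleton]⟩).trans
      (ih hAS' hS'st (hc.trans hcard) ?_)
    rw [hd3, Finset.card_erase_of_mem (Finset.mem_sdiff.2 hx), hd]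
    rfl

/-- Two separators whose union has at most `K + 1` elements are contained in separators with `K`
elements that are equal or adjacent. -/
theorem exists_tj_supersets {A B W : Finset V} {K : ℕ} (hA : IsSeparator G s t A)
    (hB : IsSeparator G s t B) (hAK : A.card ≤ K) (hBK : B.card ≤ K)
    (hU : (A ∪ B).card ≤ K + 1) (hW : W.card = K) (hsW : s ∉ W) (htW : t ∉ W) :
    ∃ S T, A ⊆ S ∧ B ⊆ T ∧ S.card = K ∧ T.card = K ∧ (s ∉ S ∧ t ∉ S) ∧ (s ∉ T ∧ t ∉ T) ∧
      Reconfigurable G s t TJAdj S T := by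
  obtain ⟨hsA, htA, -⟩ := isSeparator_iff.1 hA
  obtain ⟨hsB, htB, -⟩ := isSeparator_iff.1 hB
  have hsU : s ∉ A ∪ B := by
    rw [Finset.mem_union, not_or]
    exact ⟨hsA, hsB⟩
  have htU : t ∉ A ∪ B := by
    rw [Finset.mem_union, not_or]
    exact ⟨htA, htB⟩
  rcases Nat.lt_or_ge K (A ∪ B).card with h | h
  -- Here the union has exactly `K + 1` elements, so neither set contains the other. Dropping one
  -- private vertex of either set gives two separators one jump apart.
  · have e1 := Finset.card_sdiff_add_card A B
    have e2 := Finset.card_sdiff_add_card B A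
    rw [Finset.union_comm B A] at e2
    obtain ⟨x, hx⟩ := Finset.card_pos.1 (by omega : 0 < (A \ B).card)
    obtain ⟨y, hy⟩ := Finset.card_pos.1 (by omega : 0 < (B \ A).card)
    rw [Finset.mem_sdiff] at hx hy
    have hxU : x ∈ A ∪ B := Finset.mem_union_left _ hx.1
    have hyU : y ∈ A ∪ B := Finset.mem_union_right _ hy.1
    have hxy : x ≠ y := by rintro rfl; exact hx.2 hy.1
    have hAS : A ⊆ (A ∪ B).erase y :=
      Finset.subset_erase.2 ⟨Finset.subset_union_left, hy.2⟩
    have hBT : B ⊆ (A ∪ B).erase x :=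
      Finset.subset_erase.2 ⟨Finset.subset_union_right, hx.2⟩
    have hcS : ((A ∪ B).erase y).card = K := by rw [Finset.card_erase_of_mem hyU]; omega
    have hcT : ((A ∪ B).erase x).card = K := by rw [Finset.card_erase_of_mem hxU]; omega
    have hno : ∀ v z, v ∉ A ∪ B → v ∉ (A ∪ B).erase z :=
      fun v z h h' => h (Finset.mem_of_mem_erase h')
    refine ⟨_, _, hAS, hBT, hcS, hcT, ⟨hno _ _ hsU, hno _ _ htU⟩, ⟨hno _ _ hsU, hno _ _ htU⟩,
      .single (hA.mono hAS (hno _ _ hsU) (hno _ _ htU))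
        (hB.mono hBT (hno _ _ hsU) (hno _ _ htU)) ⟨hcS.trans hcT.symm, ?_, ?_⟩⟩
    · have : (A ∪ B).erase y \ (A ∪ B).erase x = {x} := by
        ext v
        simp only [Finset.mem_sdiff, Finset.mem_erase, Finset.mem_singleton]
        constructor
        · tauto
        · rintro rfl
          tauto
      rw [this, Finset.card_singleton]
    · have : (A ∪ B).erase x \ (A ∪ B).erase y = {y} := by
        ext v
        simp only [Finset.mem_sdiff, Finset.mem_erase, Finset.mem_singleton]
        constructor
        · tauto
        · rintro rfl
          refine ⟨⟨fun h => hxy h.symm, hyU⟩, by tauto⟩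
      rw [this, Finset.card_singleton]
  -- Here one set serves for both: the union is padded to `K` elements from `W`, whose only role is
  -- to supply enough vertices other than `s` and `t`.
  · obtain ⟨S, hUS, hSW, hS⟩ := Finset.exists_subsuperset_card_eq
      (Finset.subset_union_left (s₁ := A ∪ B) (s₂ := W)) h
      (hW ▸ Finset.card_le_card Finset.subset_union_right)
    have hno : ∀ v, v ∉ A ∪ B → v ∉ W → v ∉ S := fun v h1 h2 h3 =>
      (Finset.mem_union.1 (hSW h3)).elim h1 h2
    have hst : s ∉ S ∧ t ∉ S := ⟨hno s hsU hsW, hno t htU htW⟩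
    exact ⟨S, S, Finset.subset_union_left.trans hUS, Finset.subset_union_right.trans hUS, hS, hS,
      hst, hst, .refl⟩

/-- Members on the path can have fewer than `K` elements, so the induction is over all `K`-element
supersets of the current member avoiding `s` and `t`; any two of these are reconfigurable into each
other by `reconfigurable_tj_of_subset`. -/
theorem reconfigurable_tj_of_reflTransGen {F : ℕ → Finset V} {m K a b : ℕ}
    (ha : IsSeparator G s t (F a)) (haK : (F a).card = K) (hb : IsSeparator G s t (F b))
    (hbK : (F b).card = K)
    (h : Relation.ReflTransGen (NodeAdj G s t F m K (K + 1)) a b) :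
    Reconfigurable G s t TJAdj (F a) (F b) := by
  obtain ⟨hsa, hta, -⟩ := isSeparator_iff.1 ha
  have key : ∀ i, Relation.ReflTransGen (NodeAdj G s t F m K (K + 1)) a i →
      ∀ S, F i ⊆ S → s ∉ S ∧ t ∉ S → S.card = K → Reconfigurable G s t TJAdj (F a) S := by
    intro i hi
    induction hi with
    | refl =>
      intro S hS hst hSK
      exact reconfigurable_tj_of_subset ha subset_rfl hS ⟨hsa, hta⟩ hst (haK.trans hSK.symm)
    | tail _ hij ih =>
      intro S hS hst hSK
      obtain ⟨⟨-, hi, hiK⟩, ⟨-, hj, hjK⟩, hU⟩ := hij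
      obtain ⟨S', T', hS', hT', hS'K, hT'K, hS'st, hT'st, hST⟩ :=
        exists_tj_supersets hi hj hiK hjK hU haK hsa hta
      exact ((ih S' hS' hS'st hS'K).trans hST).trans
        (reconfigurable_tj_of_subset hj hT' hS hT'st hst (hT'K.trans hSK.symm))
  obtain ⟨hsb, htb, -⟩ := isSeparator_iff.1 hb
  exact key b h _ subset_rfl ⟨hsb, htb⟩ hbK

/-- Both ends of an edge respect the bound `K`. With the minimum of the two sizes as `K`, this
yields the answer NO under TJ for sets of different sizes, without a separate test. -/
theorem NodeAdj.eq_of_not_le {F : ℕ → Finset V} {m K M a b : ℕ}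
    (h : Relation.ReflTransGen (NodeAdj G s t F m K M) a b)
    (hK : ¬ ((F a).card ≤ K ∧ (F b).card ≤ K)) : a = b := by
  by_contra hne
  obtain h1 | ⟨c, hac, -⟩ := h.cases_head
  · exact hne h1
  obtain h1 | ⟨d, -, hdb⟩ := h.cases_tail
  · exact hne h1.symm
  exact hK ⟨hac.1.2.2, hdb.2.1.2.2⟩

/-- Reconfiguration by token addition and removal as reachability in a family of separators. -/
theorem reconfigurable_tar_iff {F : ℕ → Finset V} {m k a b : ℕ}
    (hF : ∀ S, IsSeparator G s t S → ∃ i < m, IsSeparator G s t (F i) ∧ F i ⊆ S)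
    (ha : a < m) (hb : b < m) (hsep : IsSeparator G s t (F a)) :
    Reconfigurable G s t (TARAdj k) (F a) (F b) ↔
      F a = F b ∨ Relation.ReflTransGen (NodeAdj G s t F m k k) a b := by
  constructor
  · intro h
    by_cases hK : (F a).card ≤ k
    · exact .inr (Reconfigurable.reflTransGen_nodeAdj le_rfl
        (fun S T hST _ => hST.card_union_le.2) hF ha hb hsep hK h)
    -- A source with more than `k` tokens admits no move at all, yet it is reconfigurable into
    -- itself; hence the disjunct `F a = F b`.
    · left
      obtain h | ⟨S, hS, -⟩ := Relation.ReflTransGen.cases_head h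
      · exact h
      · exact absurd hS.2.2.card_union_le.1 hK
  · rintro (h | h)
    · rw [h]
      exact .refl
    · clear hb
      induction h with
      | refl => exact .refl
      | tail _ h ih => exact Reconfigurable.trans ih h.reconfigurable_tar

/-- Reconfiguration by token jumping as reachability in a family of separators. -/
theorem reconfigurable_tj_iff {F : ℕ → Finset V} {m a b : ℕ}
    (hF : ∀ S, IsSeparator G s t S → ∃ i < m, IsSeparator G s t (F i) ∧ F i ⊆ S)
    (ha : a < m) (hb : b < m) (hsep : IsSeparator G s t (F a)) (hsep' : IsSeparator G s t (F b)) :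
    Reconfigurable G s t TJAdj (F a) (F b) ↔
      F a = F b ∨ Relation.ReflTransGen (NodeAdj G s t F m (min (F a).card (F b).card)
        (min (F a).card (F b).card + 1)) a b := by
  constructor
  · intro h
    have hcard : (F a).card = (F b).card := by
      have key : ∀ S, Reconfigurable G s t TJAdj (F a) S → (F a).card = S.card := by
        intro S hS
        induction hS with
        | refl => rfl
        | tail _ h ih => exact ih.trans h.2.2.1
      exact key _ h
    right
    rw [hcard, min_self]
    refine Reconfigurable.reflTransGen_nodeAdj (Nat.le_succ _) (fun S T hST hS => ?_) hF ha hb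
      hsep hcard.le h
    exact ⟨hST.1 ▸ hS, hST.card_union.le.trans (Nat.succ_le_succ hS)⟩
  · rintro (h | h)
    · rw [h]
      exact .refl
    · by_cases hcard : (F a).card = (F b).card
      · rw [hcard, min_self] at h
        exact reconfigurable_tj_of_reflTransGen hsep hcard hsep' rfl h
      · have := NodeAdj.eq_of_not_le h (by omega)
        subst this
        exact .refl

end Reconfiguration

/-! ## Programs with counted loops -/

theorem State.setReg_reg (σ : State) (x m y : ℕ) :
    (σ.setReg x m).reg y = if y = x then m else σ.reg y :=
  Function.update_apply _ _ _ _

theorem State.setReg_arr (σ : State) (x m : ℕ) : (σ.setReg x m).arr = σ.arr := rfl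

theorem State.setArr_reg (σ : State) (a i m : ℕ) : (σ.setArr a i m).reg = σ.reg := rfl

theorem State.setArr_arr (σ : State) (a i m b j : ℕ) :
    (σ.setArr a i m).arr b j = if b = a ∧ j = i then m else σ.arr b j := by
  by_cases h : b = a
  · subst h
    by_cases h' : j = i
    · simp [State.setArr, h']
    · simp [State.setArr, h']
  · simp [State.setArr, h]

/-- Straight-line programs with counted loops: `count x N P` runs `P` with register `x` counting
from `0` up to the content of register `N`. -/
inductive Code where
  | assign (x : ℕ) (e : Expr)
  | store (a : ℕ) (i e : Expr)
  | seq (P Q : Code)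
  | count (x N : ℕ) (P : Code)

namespace Code

/-- The memory after `i` rounds of a loop with counter `x` and body `f`. -/
def rounds (x : ℕ) (f : State → State) (σ : State) : ℕ → State
  | 0 => σ.setReg x 0
  | i + 1 => (f (rounds x f σ i)).setReg x (i + 1)

/-- The memory after the execution of a program. -/
def exec : Code → State → State
  | assign x e, σ => σ.setReg x (e.eval σ)
  | store a i e, σ => σ.setArr a (i.eval σ) (e.eval σ)
  | seq P Q, σ => Q.exec (P.exec σ)
  | count x N P, σ => rounds x P.exec σ (σ.reg N)

/-- The translation into machine programs. -/
def compile : Code → Prog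
  | assign x e => .assign x e
  | store a i e => .store a i e
  | seq P Q => .seq P.compile Q.compile
  | count x N P => .seq (.assign x (.lit 0))
      (.loop (.sub (.reg N) (.reg x)) (.seq P.compile (.assign x (.add (.reg x) (.lit 1)))))

/-- The registers that a program writes. -/
def regs : Code → List ℕ
  | assign x _ => [x]
  | store _ _ _ => []
  | seq P Q => P.regs ++ Q.regs
  | count x _ P => x :: P.regs

/-- The arrays that a program writes. -/
def arrs : Code → List ℕ
  | assign _ _ => []
  | store a _ _ => [a]
  | seq P Q => P.arrs ++ Q.arrs
  | count _ _ P => P.arrs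

/-- The registers that bound the loops of a program. -/
def bounds : Code → List ℕ
  | assign _ _ => []
  | store _ _ _ => []
  | seq P Q => P.bounds ++ Q.bounds
  | count _ N P => N :: P.bounds

/-- Loop bodies do not write the loop counter. -/
def Counted : Code → Prop
  | assign _ _ => True
  | store _ _ _ => True
  | seq P Q => P.Counted ∧ Q.Counted
  | count x _ P => x ∉ P.regs ∧ P.Counted

/-- A bound for the number of steps in terms of a bound for the numbers of rounds of the loops. -/
noncomputable def costPoly : Code → Polynomial ℕ
  | assign _ e => .C (e.cost + 1)
  | store _ i e => .C (i.cost + e.cost + 1)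
  | seq P Q => P.costPoly + Q.costPoly
  | count _ _ P => .C 6 + .X * (P.costPoly + .C 8)

end Code

/-- The memories `σ` and `τ` agree outside the registers `rs` and the arrays `as`. -/
def Agree (rs as : List ℕ) (σ τ : State) : Prop :=
  (∀ r, r ∉ rs → τ.reg r = σ.reg r) ∧ ∀ a, a ∉ as → τ.arr a = σ.arr a

theorem Agree.trans {rs as : List ℕ} {σ τ υ : State} (h : Agree rs as σ τ)
    (h' : Agree rs as τ υ) : Agree rs as σ υ :=
  ⟨fun r hr => (h'.1 r hr).trans (h.1 r hr), fun a ha => (h'.2 a ha).trans (h.2 a ha)⟩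

theorem Agree.mono {rs as rs' as' : List ℕ} {σ τ : State} (h : Agree rs as σ τ) (hr : rs ⊆ rs')
    (ha : as ⊆ as') : Agree rs' as' σ τ :=
  ⟨fun r h' => h.1 r fun hm => h' (hr hm), fun a h' => h.2 a fun hm => h' (ha hm)⟩

theorem Agree.setReg {rs as : List ℕ} {x : ℕ} (hx : x ∈ rs) (σ : State) (m : ℕ) :
    Agree rs as σ (σ.setReg x m) := by
  refine ⟨fun r hr => ?_, fun _ _ => rfl⟩
  rw [State.setReg_reg, if_neg]
  rintro rfl
  exact hr hx

namespace Code

theorem rounds_agree {x : ℕ} {f : State → State} {rs as : List ℕ} (hx : x ∈ rs)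
    (hf : ∀ τ, Agree rs as τ (f τ)) (σ : State) (i : ℕ) : Agree rs as σ (rounds x f σ i) := by
  induction i with
  | zero => exact Agree.setReg hx σ 0
  | succ i ih => exact (ih.trans (hf _)).trans (Agree.setReg hx _ _)

/-- The frame rule. For concrete programs the lists `regs` and `arrs` evaluate, so most claims that
a register or an array survives are settled by `decide`. -/
theorem exec_agree (P : Code) (σ : State) : Agree P.regs P.arrs σ (P.exec σ) := by
  induction P generalizing σ with
  | assign x e => exact Agree.setReg (by simp [regs]) σ _
  | store a i e =>
    refine ⟨fun _ _ => rfl, fun b hb => ?_⟩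
    funext j
    rw [exec, State.setArr_arr, if_neg]
    rintro ⟨rfl, -⟩
    exact hb (by simp [arrs])
  | seq P Q ihP ihQ =>
    exact ((ihP σ).mono (by simp [regs]) (by simp [arrs])).trans
      ((ihQ _).mono (by simp [regs]) (by simp [arrs]))
  | count x N P ih =>
    exact rounds_agree (by simp [regs]) (fun τ => (ih τ).mono (by simp [regs]) (by simp [arrs])) σ _

theorem exec_reg (P : Code) (σ : State) {r : ℕ} (hr : r ∉ P.regs) :
    (P.exec σ).reg r = σ.reg r :=
  (P.exec_agree σ).1 r hr

theorem exec_arr (P : Code) (σ : State) {a : ℕ} (ha : a ∉ P.arrs) :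
    (P.exec σ).arr a = σ.arr a :=
  (P.exec_agree σ).2 a ha

theorem rounds_reg_self (x : ℕ) (f : State → State) (σ : State) (i : ℕ) :
    (rounds x f σ i).reg x = i := by
  cases i <;> simp [rounds, State.setReg_reg]

/-- The invariant rule for counted loops. -/
theorem exec_count {x N : ℕ} {P : Code} {σ : State} (I : ℕ → State → Prop)
    (h0 : I 0 (σ.setReg x 0))
    (hstep : ∀ i τ, i < σ.reg N → τ.reg x = i → Agree (x :: P.regs) P.arrs σ τ → I i τ →
      I (i + 1) ((P.exec τ).setReg x (i + 1))) :
    I (σ.reg N) ((count x N P).exec σ) := by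
  have key : ∀ i, i ≤ σ.reg N → I i (rounds x P.exec σ i) := by
    intro i
    induction i with
    | zero => exact fun _ => h0
    | succ i ih =>
      intro hi
      exact hstep i _ hi (rounds_reg_self _ _ _ _)
        (rounds_agree (by simp) (fun τ => (P.exec_agree τ).mono (by simp) (by simp)) σ i)
        (ih (Nat.le_of_succ_le hi))
  exact key _ le_rfl

/-- A program halts with the memory `exec` within the number of steps given by `costPoly`. -/
theorem runs_compile (P : Code) (hP : P.Counted) {σ : State} {B : ℕ}
    (hb : ∀ N ∈ P.bounds, N ∉ P.regs ∧ σ.reg N ≤ B) :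
    ∃ c, Runs P.compile σ (P.exec σ) c ∧ c ≤ P.costPoly.eval B := by
  induction P generalizing σ with
  | assign x e => exact ⟨_, .assign σ x e, by simp [costPoly]⟩
  | store a i e => exact ⟨_, .store σ a i e, by simp [costPoly]⟩
  | seq P Q ihP ihQ =>
    simp only [bounds, regs, List.mem_append, not_or] at hb
    obtain ⟨c, hc, hcB⟩ := ihP hP.1 (σ := σ) fun N hN => ⟨(hb N (.inl hN)).1.1, (hb N (.inl hN)).2⟩
    obtain ⟨d, hd, hdB⟩ := ihQ hP.2 (σ := P.exec σ) fun N hN => by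
      refine ⟨(hb N (.inr hN)).1.2, ?_⟩
      rw [P.exec_reg σ (hb N (.inr hN)).1.1]
      exact (hb N (.inr hN)).2
    refine ⟨c + d, .seq hc hd, ?_⟩
    rw [costPoly, Polynomial.eval_add]
    exact Nat.add_le_add hcB hdB
  | count x N P ih =>
    simp only [bounds, regs, List.mem_cons, not_or, forall_eq_or_imp] at hb
    obtain ⟨⟨⟨hNx, hNP⟩, hNB⟩, hb⟩ := hb
    have hagree : ∀ i, Agree (x :: P.regs) P.arrs σ (rounds x P.exec σ i) := fun i =>
      rounds_agree (by simp) (fun τ => (P.exec_agree τ).mono (by simp) (by simp)) σ i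
    have hN : ∀ i, (rounds x P.exec σ i).reg N = σ.reg N := fun i =>
      (hagree i).1 N (by simp [hNx, hNP])
    -- With `k` rounds left: the failing last test costs 4, and a round costs 4 for the test, 4 for
    -- the increment, and the body. The initial assignment costs 2 more, whence the 6 in `costPoly`.
    have key : ∀ k i, i + k = σ.reg N → ∃ c,
        Runs (.loop (.sub (.reg N) (.reg x)) (.seq P.compile (.assign x (.add (.reg x) (.lit 1)))))
          (rounds x P.exec σ i) (rounds x P.exec σ (σ.reg N)) c ∧
        c ≤ 4 + k * (P.costPoly.eval B + 8) := by
      intro k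
      induction k with
      | zero =>
        rintro i hi
        obtain rfl : i = σ.reg N := by omega
        refine ⟨_, .loop_false ?_, ?_⟩
        · simp [Expr.eval, hN, rounds_reg_self]
        · simp [Expr.cost]
      | succ k ihk =>
        intro i hi
        obtain ⟨c, hc, hcB⟩ := ih hP.2 (σ := rounds x P.exec σ i) fun M hM => by
          obtain ⟨⟨h1, h2⟩, h3⟩ := hb M hM
          exact ⟨h2, ((hagree i).1 M (by simp [h1, h2])).trans_le h3⟩
        obtain ⟨d, hd, hdB⟩ := ihk (i + 1) (by omega)
        have hassign := Runs.assign (P.exec (rounds x P.exec σ i)) x (.add (.reg x) (.lit 1))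
        have hx : (Expr.add (.reg x) (.lit 1)).eval (P.exec (rounds x P.exec σ i)) = i + 1 := by
          simp only [Expr.eval, P.exec_reg _ hP.1, rounds_reg_self]
        rw [hx] at hassign
        refine ⟨_, .loop_true ?_ (.seq hc hassign) hd, ?_⟩
        · simp only [Expr.eval, hN, rounds_reg_self]
          omega
        · simp only [Expr.cost]
          rw [Nat.succ_mul]
          omega
    obtain ⟨c, hc, hcB⟩ := key (σ.reg N) 0 (by omega)
    refine ⟨_, .seq (.assign σ x (.lit 0)) hc, ?_⟩
    simp only [Expr.cost, costPoly, Polynomial.eval_add, Polynomial.eval_mul, Polynomial.eval_C,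
      Polynomial.eval_X]
    have := Nat.mul_le_mul_right (P.costPoly.eval B + 8) hNB
    omega

end Code

/-! ## Reachability -/

/-- Marks in array `a` everything that can be reached along a relation on the numbers below the
content of register `N`, if the program `P` puts the truth value of the relation between the contents
of the registers `10` and `11` into register `13`. -/
def reachRound (a N : ℕ) (P : Code) : Code :=
  .count 10 N (.count 11 N (.seq P (.store a (.reg 11)
    (.sub (.lit 1) (.sub (.lit 1) (.add (.read a (.reg 11))
      (.sub (.add (.read a (.reg 10)) (.reg 13)) (.lit 1))))))))

/-- As many rounds as there are elements suffice, since every round before saturation marks a new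
one. -/
def reachCode (a N : ℕ) (P : Code) : Code :=
  .count 9 N (reachRound a N P)

section Reach

variable {a N m : ℕ} {P : Code} {E : ℕ → ℕ → Prop} {σ : State}

/-- The first `m` cells of array `a` hold the indicator function of `S`. -/
def Marks (a m : ℕ) (S : Set ℕ) (σ : State) : Prop :=
  (∀ i < m, i ∈ S → σ.arr a i = 1) ∧ ∀ i < m, i ∉ S → σ.arr a i = 0

/-- Marks are updated in place, so one round may follow several edges. The new set is therefore only
confined: it contains `S` and the successors of `S`, and lies in every closed set that contains `S`.
-/
theorem reachRound_marks (h10 : 10 ∉ P.regs) (h11 : 11 ∉ P.regs)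
    (hN : N ∉ (reachCode a N P).regs) (ha : a ∉ P.arrs) (hm : σ.reg N = m)
    (hP : ∀ τ, Agree (reachCode a N P).regs (reachCode a N P).arrs σ τ → τ.reg 10 < m →
      τ.reg 11 < m → (E (τ.reg 10) (τ.reg 11) → (P.exec τ).reg 13 = 1) ∧
        (¬ E (τ.reg 10) (τ.reg 11) → (P.exec τ).reg 13 = 0))
    {τ : State} (hτ : Agree (reachCode a N P).regs (reachCode a N P).arrs σ τ) {S : Set ℕ}
    (hS : Marks a m S τ) :
    ∃ S', Marks a m S' ((reachRound a N P).exec τ) ∧ S ⊆ S' ∧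
      (∀ u v, u ∈ S → u < m → v < m → E u v → v ∈ S') ∧
      ∀ Q : Set ℕ, (∀ u v, u ∈ Q → E u v → v ∈ Q) → S ⊆ Q → S' ⊆ Q := by
  have hregN : ∀ υ, Agree (reachCode a N P).regs (reachCode a N P).arrs σ υ → υ.reg N = m :=
    fun υ hυ => (hυ.1 N hN).trans hm
  -- The arbitrary assignment of `k` to register `r` absorbs the counter update of the surrounding
  -- loop; marks concern arrays only.
  have hstep : ∀ υ, Agree (reachCode a N P).regs (reachCode a N P).arrs σ υ → υ.reg 10 < m →
      υ.reg 11 < m → ∀ S, Marks a m S υ → ∀ r k,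
      Marks a m (S ∪ {v | v = υ.reg 11 ∧ υ.reg 10 ∈ S ∧ E (υ.reg 10) v})
        (((Code.seq P (.store a (.reg 11)
          (.sub (.lit 1) (.sub (.lit 1) (.add (.read a (.reg 11))
          (.sub (.add (.read a (.reg 10)) (.reg 13)) (.lit 1))))))).exec υ).setReg r k) := by
    intro υ hυ hu hv S hS r k
    obtain ⟨hE1, hE0⟩ := hP υ hυ hu hv
    have hread : ∀ w, ((P.exec υ).arr a) w = υ.arr a w := fun w => by rw [P.exec_arr υ ha]
    constructor
    all_goals
      intro i hi hiS
      rw [State.setReg_arr, Code.exec, Code.exec, State.setArr_arr]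
      simp only [Expr.eval, hread, P.exec_reg υ h10, P.exec_reg υ h11, true_and]
      simp only [Set.mem_union, Set.mem_ofPred_eq] at hiS
    · by_cases hi11 : i = υ.reg 11
      · rw [if_pos hi11]
        rcases hiS with hiS | ⟨-, huS, hE⟩
        · have := hS.1 i hi hiS
          rw [hi11] at this
          omega
        · have := hS.1 _ hu huS
          have := hE1 (hi11 ▸ hE)
          omega
      · rw [if_neg hi11]
        exact hS.1 i hi (hiS.resolve_right fun h => hi11 h.1)
    · rw [not_or] at hiS
      by_cases hi11 : i = υ.reg 11
      · rw [if_pos hi11]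
        have h0 := hS.2 i hi hiS.1
        rw [hi11] at h0
        by_cases hE : E (υ.reg 10) (υ.reg 11)
        · have h1 := hS.2 _ hu fun huS => hiS.2 ⟨hi11, huS, hi11 ▸ hE⟩
          have h2 := hE1 hE
          omega
        · have h2 := hE0 hE
          have h3 : υ.arr a (υ.reg 10) ≤ 1 := by
            by_cases huS : υ.reg 10 ∈ S
            · exact (hS.1 _ hu huS).le
            · exact (hS.2 _ hu huS).le.trans zero_le_one
          omega
      · rw [if_neg hi11]
        exact hS.2 i hi hiS.1
  have hrow : ∀ υ, Agree (reachCode a N P).regs (reachCode a N P).arrs σ υ → υ.reg 10 < m →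
      ∀ S, Marks a m S υ → ∀ r k,
      ∃ S', Marks a m S' (((Code.count 11 N (.seq P (.store a (.reg 11)
          (.sub (.lit 1) (.sub (.lit 1) (.add (.read a (.reg 11))
          (.sub (.add (.read a (.reg 10)) (.reg 13)) (.lit 1)))))))).exec υ).setReg r k) ∧ S ⊆ S' ∧
        (∀ v, υ.reg 10 ∈ S → v < m → E (υ.reg 10) v → v ∈ S') ∧
        ∀ Q : Set ℕ, (∀ u v, u ∈ Q → E u v → v ∈ Q) → S ⊆ Q → S' ⊆ Q := by
    intro υ hυ hu S hS r k
    have := Code.exec_count (x := 11) (N := N) (σ := υ) (P := .seq P (.store a (.reg 11)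
          (.sub (.lit 1) (.sub (.lit 1) (.add (.read a (.reg 11))
          (.sub (.add (.read a (.reg 10)) (.reg 13)) (.lit 1)))))))
      (I := fun j ω => ∃ S', Marks a m S' ω ∧ S ⊆ S' ∧
        (∀ v, υ.reg 10 ∈ S → v < j → E (υ.reg 10) v → v ∈ S') ∧
        ∀ Q : Set ℕ, (∀ u v, u ∈ Q → E u v → v ∈ Q) → S ⊆ Q → S' ⊆ Q)
      ⟨S, hS, subset_rfl, fun v _ h => absurd h (Nat.not_lt_zero v), fun Q _ h => h⟩ ?_
    · rw [hregN υ hυ] at this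
      exact this
    · rintro j ω hj hωj hω ⟨S', hS', hSS', hE, hQ⟩
      rw [hregN υ hυ] at hj
      have hω10 : ω.reg 10 = υ.reg 10 := hω.1 10 (by simp [Code.regs, h10])
      refine ⟨_, hstep ω (hυ.trans (hω.mono ?_ ?_)) (hω10 ▸ hu) (hωj ▸ hj) S' hS' _ _,
        hSS'.trans Set.subset_union_left, ?_, ?_⟩
      · intro; simp [reachCode, reachRound, Code.regs]; tauto
      · intro; simp [reachCode, reachRound, Code.arrs]
      · intro v huS hv huv
        rcases Nat.lt_succ_iff_lt_or_eq.1 hv with hv | rfl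
        · exact .inl (hE v huS hv huv)
        · right
          refine ⟨hωj.symm, ?_, ?_⟩
          · rw [hω10]
            exact hSS' huS
          · rw [hω10]
            exact huv
      · intro Q hQE hSQ
        refine Set.union_subset (hQ Q hQE hSQ) ?_
        rintro v ⟨-, hu', huv⟩
        exact hQE _ _ (hQ Q hQE hSQ hu') huv
  have := Code.exec_count (x := 10) (N := N) (σ := τ) (P := .count 11 N (.seq P (.store a (.reg 11)
          (.sub (.lit 1) (.sub (.lit 1) (.add (.read a (.reg 11))
          (.sub (.add (.read a (.reg 10)) (.reg 13)) (.lit 1))))))))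
    (I := fun j ω => ∃ S', Marks a m S' ω ∧ S ⊆ S' ∧
      (∀ u v, u ∈ S → u < j → v < m → E u v → v ∈ S') ∧
      ∀ Q : Set ℕ, (∀ u v, u ∈ Q → E u v → v ∈ Q) → S ⊆ Q → S' ⊆ Q)
    ⟨S, hS, subset_rfl, fun u v _ h => absurd h (Nat.not_lt_zero u), fun Q _ h => h⟩ ?_
  · rw [hregN τ hτ] at this
    exact this
  · rintro j ω hj hωj hω ⟨S', hS', hSS', hE, hQ⟩
    rw [hregN τ hτ] at hj
    obtain ⟨S'', h1, h2, h3, h4⟩ := hrow ω (hτ.trans (hω.mono (by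
      intro; simp [reachCode, reachRound, Code.regs]; tauto) (by
      intro; simp [reachCode, reachRound, Code.arrs]))) (hωj ▸ hj) S' hS' 10 (j + 1)
    refine ⟨S'', h1, hSS'.trans h2, ?_, fun Q hQE hSQ => h4 Q hQE (hQ Q hQE hSQ)⟩
    intro u v huS hu hv huv
    rcases Nat.lt_succ_iff_lt_or_eq.1 hu with hu | rfl
    · exact h2 (hE u v huS hu hv huv)
    · rw [hωj] at h3
      exact h3 v (hSS' huS) hv huv

/-- The reachability program marks the set of everything reachable from `s₀`. -/
theorem reachCode_marks (h10 : 10 ∉ P.regs) (h11 : 11 ∉ P.regs)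
    (hN : N ∉ (reachCode a N P).regs) (ha : a ∉ P.arrs) (hm : σ.reg N = m)
    (hE : ∀ u v, E u v → v < m)
    (hP : ∀ τ, Agree (reachCode a N P).regs (reachCode a N P).arrs σ τ → τ.reg 10 < m →
      τ.reg 11 < m → (E (τ.reg 10) (τ.reg 11) → (P.exec τ).reg 13 = 1) ∧
        (¬ E (τ.reg 10) (τ.reg 11) → (P.exec τ).reg 13 = 0))
    {s₀ : ℕ} (hs₀ : s₀ < m) (hσ : Marks a m {s₀} σ) :
    Marks a m {v | Relation.ReflTransGen E s₀ v} ((reachCode a N P).exec σ) := by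
  -- After `k` rounds the marked set is closed or has at least `k + 1` elements. For `k = m` the
  -- second case is impossible.
  have := Code.exec_count (x := 9) (N := N) (σ := σ) (P := reachRound a N P)
    (I := fun k τ => ∃ S : Finset ℕ, Marks a m S τ ∧ s₀ ∈ S ∧ (∀ v ∈ S, v < m) ∧
      (∀ Q : Set ℕ, (∀ u v, u ∈ Q → E u v → v ∈ Q) → s₀ ∈ Q → (S : Set ℕ) ⊆ Q) ∧
      ((∀ u v, u ∈ S → E u v → v ∈ S) ∨ k + 1 ≤ S.card))
    ⟨{s₀}, by simpa [Marks, State.setReg_arr] using hσ, by simp, by simpa using hs₀, by simp, by simp⟩ ?_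
  · obtain ⟨S, hS, hs, hSm, hQ, hcl⟩ := this
    rw [hm] at hcl
    have hcl : ∀ u v, u ∈ S → E u v → v ∈ S := by
      refine hcl.resolve_right fun h => ?_
      have : S.card ≤ (Finset.range m).card :=
        Finset.card_le_card fun v hv => Finset.mem_range.2 (hSm v hv)
      rw [Finset.card_range] at this
      omega
    have hSeq : (S : Set ℕ) = {v | Relation.ReflTransGen E s₀ v} := by
      refine Set.Subset.antisymm (hQ _ (fun u v hu huv => hu.tail huv) .refl) fun v hv => ?_
      induction hv with
      | refl => exact hs
      | tail _ h ih => exact hcl _ _ ih h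
    rw [← hSeq]
    exact hS
  · rintro k τ hk - hτ ⟨S, hS, hs, hSm, hQ, hcl⟩
    obtain ⟨S', hS', hSS', hstep, hQ'⟩ := reachRound_marks h10 h11 hN ha hm hP hτ hS
    have hSm' : S' ⊆ {v | v < m} := hQ' _ (fun u v _ huv => hE u v huv) fun v hv => hSm v hv
    have hfin : S'.Finite := (Set.finite_lt_nat m).subset hSm'
    obtain ⟨T, rfl⟩ := hfin.exists_finset_coe
    refine ⟨T, hS', hSS' hs, fun v hv => hSm' hv, fun Q hQE hsQ => hQ' Q hQE (hQ Q hQE hsQ), ?_⟩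
    by_cases hclosed : ∀ u v, u ∈ S → E u v → v ∈ S
    · left
      -- A closed `S` is itself among the closed sets that bound the next round, so nothing is
      -- added.
      have hTS : (T : Set ℕ) ⊆ S := hQ' S (fun u v hu huv => hclosed u v hu huv) subset_rfl
      exact fun u v hu huv => hSS' (hclosed u v (hTS hu) huv)
    · right
      have hk := hcl.resolve_left hclosed
      push Not at hclosed
      obtain ⟨u, v, hu, huv, hv⟩ := hclosed
      have hlt : S.card < T.card := Finset.card_lt_card
        ⟨fun w hw => hSS' hw, fun h => hv (h (hstep u v hu (hSm u hu) (hE u v huv) huv))⟩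
      omega

end Reach

/-! ## The program -/

/-- Puts `n` into register `4` and `n * n + 2` into register `5`. -/
def sizeCode : Code :=
  .seq (.assign 4 (.reg 0)) (.seq (.assign 5 (.lit 2))
    (.count 6 0 (.assign 5 (.add (.reg 5) (.reg 4)))))

/-- Puts `i * n` into cell `i` of array `3`. -/
def tableCode : Code :=
  .seq (.assign 7 (.lit 0)) (.count 6 5
    (.seq (.store 3 (.reg 6) (.reg 7)) (.assign 7 (.add (.reg 7) (.reg 4)))))

/-- Appends the values of `e` for `n` values of register `8` to array `4`. -/
def rowCode (e : Expr) : Code :=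
  .count 8 4 (.seq (.store 4 (.reg 7) e) (.assign 7 (.add (.reg 7) (.lit 1))))

/-- Membership of the content of register `8` in the common neighborhood of the contents of
registers `6` and `12`. -/
def pairExpr : Expr :=
  .sub (.add (.read 0 (.add (.read 3 (.reg 6)) (.reg 8)))
    (.read 0 (.add (.read 3 (.reg 12)) (.reg 8)))) (.lit 1)

/-- Writes the membership matrix of all common neighborhoods, the source and the target into
array `4`. -/
def familyCode : Code :=
  .seq (.assign 7 (.lit 0)) (.seq (.count 6 4 (.count 12 4 (rowCode pairExpr)))
    (.seq (rowCode (.read 1 (.reg 8))) (rowCode (.read 2 (.reg 8)))))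

/-- Membership of the content of register `w` in the set whose index is in register `i`. -/
def memExpr (i w : ℕ) : Expr :=
  .read 4 (.add (.read 3 (.reg i)) (.reg w))

/-- Puts the size of the union of the sets with indices in registers `i` and `j` into register
`q`. -/
def unionCode (i j q : ℕ) : Code :=
  .seq (.assign q (.lit 0)) (.count 12 4 (.assign q (.add (.reg q)
    (.sub (.lit 1) (.sub (.lit 1) (.add (memExpr i 12) (memExpr j 12)))))))

/-- Steps along edges that end outside the set with index in register `6`. -/
def edgeCode : Code :=
  .assign 13 (.sub (.read 0 (.add (.read 3 (.reg 10)) (.reg 11))) (memExpr 6 11))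

/-- Puts into cell `i` of array `6` whether the set with index `i` is a separator whose size is at
most the content of register `3`, for the content `i` of register `6`. -/
def validRow : Code :=
  .seq (.count 9 4 (.store 7 (.reg 9) (.lit 0))) (.seq (.store 7 (.reg 1) (.lit 1))
    (.seq (reachCode 7 4 edgeCode) (.seq (unionCode 6 6 16)
      (.store 6 (.reg 6) (.sub (.lit 1) (.add (.add (memExpr 6 1) (memExpr 6 2))
        (.add (.read 7 (.reg 2)) (.sub (.reg 16) (.reg 3)))))))))

def validCode : Code :=
  .count 6 5 validRow

/-- Adjacency of the sets with indices in registers `10` and `11`. -/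
def nodeCode : Code :=
  .seq (unionCode 10 11 16) (.assign 13 (.sub (.sub (.add (.read 6 (.reg 10)) (.read 6 (.reg 11)))
    (.lit 1)) (.sub (.reg 16) (.reg 14))))

/-- Registers 17 and 18 receive the indices `n * n` and `n * n + 1` of source and target; registers
19, 20, 21 receive the sizes of their union, of the source and of the target. -/
def setupCode : Code :=
  .seq tableCode (.seq familyCode (.seq (.assign 17 (.sub (.reg 5) (.lit 2)))
    (.seq (.assign 18 (.sub (.reg 5) (.lit 1))) (.seq (unionCode 17 18 19)
      (.seq (unionCode 17 17 20) (unionCode 18 18 21))))))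

/-- The answer is the disjunction of the mark of the target and the equality of source and target.
The latter is tested by comparing the size of the union with both sizes. -/
def searchCode : Code :=
  .seq validCode (.seq (.store 8 (.reg 17) (.lit 1)) (.seq (reachCode 8 5 nodeCode)
    (.assign 0 (.sub (.lit 1) (.sub (.lit 1) (.add (.read 8 (.reg 18))
      (.sub (.lit 1) (.add (.sub (.reg 19) (.reg 20)) (.sub (.reg 19) (.reg 21))))))))))

/-! ### Correctness of the initial loops -/

theorem sizeCode_exec (σ : State) :
    (sizeCode.exec σ).reg 4 = σ.reg 0 ∧ (sizeCode.exec σ).reg 5 = σ.reg 0 * σ.reg 0 + 2 := by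
  set σ' := (σ.setReg 4 (σ.reg 0)).setReg 5 2 with hσ'
  have h0 : σ'.reg 0 = σ.reg 0 := by simp [hσ', State.setReg_reg]
  have h4 : σ'.reg 4 = σ.reg 0 := by simp [hσ', State.setReg_reg]
  have h5 : σ'.reg 5 = 2 := by simp [hσ', State.setReg_reg]
  have := Code.exec_count (x := 6) (N := 0) (P := .assign 5 (.add (.reg 5) (.reg 4))) (σ := σ')
    (I := fun i τ => τ.reg 5 = i * σ.reg 0 + 2) (by simp [State.setReg_reg, h5]) ?_
  · rw [h0] at this
    refine ⟨?_, this⟩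
    exact (Code.exec_reg (.count 6 0 (.assign 5 (.add (.reg 5) (.reg 4)))) σ'
      (by decide)).trans h4
  · intro i τ _ _ hτ h
    have hτ4 : τ.reg 4 = σ.reg 0 := (hτ.1 4 (by decide)).trans h4
    simp only [Code.exec, State.setReg_reg, Expr.eval, h, hτ4]
    simp
    ring

theorem tableCode_exec (σ : State) {i : ℕ} (hi : i < σ.reg 5) :
    (tableCode.exec σ).arr 3 i = i * σ.reg 4 := by
  have := Code.exec_count (x := 6) (N := 5) (σ := σ.setReg 7 0)
    (P := .seq (.store 3 (.reg 6) (.reg 7)) (.assign 7 (.add (.reg 7) (.reg 4))))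
    (I := fun i τ => τ.reg 7 = i * σ.reg 4 ∧ ∀ j < i, τ.arr 3 j = j * σ.reg 4)
    (by simp [State.setReg_reg]) ?_
  · exact this.2 i (by simpa [State.setReg_reg] using hi)
  · rintro i τ _ hi hτ ⟨h7, h⟩
    have hτ4 : τ.reg 4 = σ.reg 4 := (hτ.1 4 (by decide)).trans (by simp [State.setReg_reg])
    simp only [Code.exec, State.setReg_reg, State.setReg_arr, State.setArr_reg, State.setArr_arr,
      Expr.eval, h7, hτ4, hi]
    refine ⟨by simp; ring, fun j hj => ?_⟩
    rcases Nat.lt_succ_iff_lt_or_eq.1 hj with hj | rfl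
    · simp [hj.ne, h j hj]
    · simp

/-- Register 7 is the write position, and all cells below it agree with `g`. One `g` for the whole
array lets consecutive rows be chained. -/
theorem rowCode_exec {e : Expr} {σ : State} {g : ℕ → ℕ}
    (hg : ∀ τ, Agree (rowCode e).regs (rowCode e).arrs σ τ → τ.reg 8 < σ.reg 4 →
      e.eval τ = g (σ.reg 7 + τ.reg 8))
    (h : ∀ p < σ.reg 7, σ.arr 4 p = g p) :
    ((rowCode e).exec σ).reg 7 = σ.reg 7 + σ.reg 4 ∧
      ∀ p < σ.reg 7 + σ.reg 4, ((rowCode e).exec σ).arr 4 p = g p := by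
  refine Code.exec_count (x := 8) (N := 4) (σ := σ)
    (P := .seq (.store 4 (.reg 7) e) (.assign 7 (.add (.reg 7) (.lit 1))))
    (I := fun i τ => τ.reg 7 = σ.reg 7 + i ∧ ∀ p < σ.reg 7 + i, τ.arr 4 p = g p)
    (by simpa [State.setReg_reg, State.setReg_arr] using h) ?_
  rintro i τ hi h8 hτ ⟨h7, hp⟩
  have he := hg τ hτ (h8 ▸ hi)
  simp only [Code.exec, State.setReg_reg, State.setReg_arr, State.setArr_reg, State.setArr_arr,
    Expr.eval, h7, he, h8]
  refine ⟨by simp; ring, fun p hp' => ?_⟩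
  by_cases hpe : p = σ.reg 7 + i
  · simp [hpe]
  · simp [hpe, hp p (by omega)]

theorem familyCode_exec {σ : State} {n : ℕ} {g : ℕ → ℕ} (hn : σ.reg 4 = n)
    (h3 : ∀ i < n, σ.arr 3 i = i * n)
    (hg : ∀ x < n, ∀ y < n, ∀ w < n,
      g ((x * n + y) * n + w) = σ.arr 0 (x * n + w) + σ.arr 0 (y * n + w) - 1)
    (hg₁ : ∀ w < n, g (n * n * n + w) = σ.arr 1 w)
    (hg₂ : ∀ w < n, g ((n * n + 1) * n + w) = σ.arr 2 w) {p : ℕ} (hp : p < (n * n + 2) * n) :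
    (familyCode.exec σ).arr 4 p = g p := by
  set σ₀ := σ.setReg 7 0 with hσ₀
  have hpair := Code.exec_count (x := 6) (N := 4) (P := .count 12 4 (rowCode pairExpr)) (σ := σ₀)
    (I := fun x τ => τ.reg 7 = x * n * n ∧ ∀ p < x * n * n, τ.arr 4 p = g p)
    (by simp [State.setReg_reg, hσ₀]) ?_
  · have h4 : σ₀.reg 4 = n := by simp [hσ₀, State.setReg_reg, hn]
    rw [h4] at hpair
    have hag₁ := (Code.count 6 4 (.count 12 4 (rowCode pairExpr))).exec_agree σ₀
    set σ₁ := (Code.count 6 4 (.count 12 4 (rowCode pairExpr))).exec σ₀ with hσ₁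
    obtain ⟨h7, harr⟩ := hpair
    have h4₁ : σ₁.reg 4 = n := (hag₁.1 4 (by decide)).trans h4
    have hrow₁ := rowCode_exec (σ := σ₁) (e := .read 1 (.reg 8)) (g := g) (fun τ hτ h8 => by
      rw [h7, hg₁ _ (h4₁ ▸ h8), Expr.eval, Expr.eval, hτ.2 1 (by decide), hag₁.2 1 (by decide)]
      rfl) (by rw [h7]; exact harr)
    have hag₂ := (rowCode (.read 1 (.reg 8))).exec_agree σ₁
    set σ₂ := (rowCode (.read 1 (.reg 8))).exec σ₁ with hσ₂
    rw [h7, h4₁] at hrow₁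
    have h4₂ : σ₂.reg 4 = n := (hag₂.1 4 (by decide)).trans h4₁
    have hrow₂ := rowCode_exec (σ := σ₂) (e := .read 2 (.reg 8)) (g := g) (fun τ hτ h8 => by
      rw [hrow₁.1, Expr.eval, Expr.eval, hτ.2 2 (by decide), hag₂.2 2 (by decide),
        hag₁.2 2 (by decide)]
      have := hg₂ _ (h4₂ ▸ h8)
      rw [Nat.add_mul, Nat.one_mul] at this
      exact this.symm) (by rw [hrow₁.1]; exact hrow₁.2)
    refine hrow₂.2 p ?_
    rw [hrow₁.1, h4₂]
    linarith
  · rintro x τ hx h6 hτ ⟨h7, harr⟩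
    have h4 : σ₀.reg 4 = n := by simp [hσ₀, State.setReg_reg, hn]
    rw [h4] at hx
    have hτ4 : τ.reg 4 = n := (hτ.1 4 (by decide)).trans h4
    have hin := Code.exec_count (x := 12) (N := 4) (P := rowCode pairExpr) (σ := τ)
      (I := fun y ω => ω.reg 7 = (x * n + y) * n ∧ ∀ p < (x * n + y) * n, ω.arr 4 p = g p)
      (by simpa [State.setReg_reg, State.setReg_arr, h7] using harr) ?_
    · rw [hτ4] at hin
      have e : (x + 1) * n * n = (x * n + n) * n := by ring
      simpa [State.setReg_reg, State.setReg_arr, e, Code.exec] using hin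
    · rintro y ω hy h12 hω ⟨h7', harr'⟩
      rw [hτ4] at hy
      have hω4 : ω.reg 4 = n := (hω.1 4 (by decide)).trans hτ4
      have hω6 : ω.reg 6 = x := (hω.1 6 (by decide)).trans h6
      have := rowCode_exec (σ := ω) (e := pairExpr) (g := g) (fun υ hυ h8 => by
        have a0 : υ.arr 0 = σ.arr 0 := (hυ.2 0 (by decide)).trans
          ((hω.2 0 (by decide)).trans (hτ.2 0 (by decide)))
        have a3 : υ.arr 3 = σ.arr 3 := (hυ.2 3 (by decide)).trans
          ((hω.2 3 (by decide)).trans (hτ.2 3 (by decide)))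
        have r6 : υ.reg 6 = x := (hυ.1 6 (by decide)).trans hω6
        have r12 : υ.reg 12 = y := (hυ.1 12 (by decide)).trans h12
        rw [h7', hg x hx y hy _ (hω4 ▸ h8)]
        simp only [pairExpr, Expr.eval, a0, a3, r6, r12, h3 x hx, h3 y hy])
        (by rw [h7']; exact harr')
      rw [h7', hω4] at this
      have e : (x * n + (y + 1)) * n = (x * n + y) * n + n := by ring
      simpa [State.setReg_reg, State.setReg_arr, e] using this

/-- The memory holds the graph, the table of multiples and the membership matrix of a family of
vertex sets. -/
structure Holds {n : ℕ} (G : SimpleGraph (Fin n)) (s t : Fin n) (F : ℕ → Finset (Fin n)) (m : ℕ)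
    (σ : State) : Prop where
  le : n ≤ m
  reg_one : σ.reg 1 = s
  reg_two : σ.reg 2 = t
  reg_four : σ.reg 4 = n
  reg_five : σ.reg 5 = m
  graph : σ.arr 0 = graphArray G
  table : ∀ i < m, σ.arr 3 i = i * n
  family : ∀ i < m, ∀ v : Fin n, σ.arr 4 (i * n + v) = setArray (F i) v

theorem setArray_apply {n : ℕ} (S : Finset (Fin n)) (v : Fin n) :
    setArray S v = if v ∈ S then 1 else 0 := by
  unfold setArray
  congr 1
  apply propext
  constructor
  · rintro ⟨w, hw, h⟩
    rwa [Fin.ext h]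
  · exact fun h => ⟨v, h, rfl⟩

theorem mul_add_inj {n x y x' y' : ℕ} (hy : y < n) (hy' : y' < n)
    (h : x * n + y = x' * n + y') : x = x' ∧ y = y' := by
  have hn : 0 < n := by omega
  have h1 : x = x' := by
    have := congrArg (· / n) h
    simpa [Nat.add_comm, Nat.add_mul_div_right _ _ hn, Nat.div_eq_of_lt, hy, hy'] using this
  subst h1
  exact ⟨rfl, by omega⟩

theorem graphArray_apply {n : ℕ} (G : SimpleGraph (Fin n)) [DecidableRel G.Adj] (u v : Fin n) :
    graphArray G (u * n + v) = if G.Adj u v then 1 else 0 := by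
  unfold graphArray
  have : (∃ u' v' : Fin n, G.Adj u' v' ∧ (u : ℕ) * n + v = u' * n + v') ↔ G.Adj u v := by
    constructor
    · rintro ⟨u', v', h, e⟩
      obtain ⟨h1, h2⟩ := mul_add_inj v.2 v'.2 e
      rwa [Fin.ext h1, Fin.ext h2]
    · exact fun h => ⟨u, v, h, rfl⟩
  by_cases h : G.Adj u v
  · rw [if_pos (this.2 h), if_pos h]
  · rw [if_neg fun h' => h (this.1 h'), if_neg h]

/-! ### Correctness of the separator tests and of the search -/

section Correct

variable {n : ℕ} {G : SimpleGraph (Fin n)} {s t : Fin n} {F : ℕ → Finset (Fin n)} {m : ℕ}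
  {σ τ : State}

theorem Holds.of_agree {rs as : List ℕ} (h : Holds G s t F m σ) (hτ : Agree rs as σ τ)
    (hr : 1 ∉ rs ∧ 2 ∉ rs ∧ 4 ∉ rs ∧ 5 ∉ rs) (ha : 0 ∉ as ∧ 3 ∉ as ∧ 4 ∉ as) :
    Holds G s t F m τ where
  le := h.le
  reg_one := (hτ.1 1 hr.1).trans h.reg_one
  reg_two := (hτ.1 2 hr.2.1).trans h.reg_two
  reg_four := (hτ.1 4 hr.2.2.1).trans h.reg_four
  reg_five := (hτ.1 5 hr.2.2.2).trans h.reg_five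
  graph := (hτ.2 0 ha.1).trans h.graph
  table := by rw [hτ.2 3 ha.2.1]; exact h.table
  family := by rw [hτ.2 4 ha.2.2]; exact h.family

theorem Holds.memExpr_eval (h : Holds G s t F m σ) {i w : ℕ} (hi : σ.reg i < m) (v : Fin n)
    (hv : σ.reg w = v) : (memExpr i w).eval σ = if v ∈ F (σ.reg i) then 1 else 0 := by
  rw [memExpr, Expr.eval, Expr.eval, Expr.eval, Expr.eval, Expr.eval, h.table _ hi, hv,
    h.family _ hi, setArray_apply]

/-- After `w` rounds register `q` counts the vertices of the union below `w`. The side conditions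
keep the counter, register 12, and the accumulator `q` from overwriting the indices and the data. -/
theorem Holds.unionCode_exec (h : Holds G s t F m σ) {i j q : ℕ} (hi : σ.reg i < m)
    (hj : σ.reg j < m) (hi12 : i ≠ 12) (hj12 : j ≠ 12) (hiq : i ≠ q) (hjq : j ≠ q)
    (hq : q ∉ [1, 2, 4, 5, 12]) :
    ((unionCode i j q).exec σ).reg q = (F (σ.reg i) ∪ F (σ.reg j)).card := by
  simp only [List.mem_cons, List.not_mem_nil, or_false, not_or] at hq
  have h' : Holds G s t F m (σ.setReg q 0) :=
    h.of_agree (Agree.setReg (rs := [q]) (as := []) (by simp) σ 0)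
      (by simp only [List.mem_singleton]; omega) (by simp)
  have := Code.exec_count (x := 12) (N := 4) (σ := σ.setReg q 0)
    (P := .assign q (.add (.reg q)
      (.sub (.lit 1) (.sub (.lit 1) (.add (memExpr i 12) (memExpr j 12))))))
    (I := fun w τ => τ.reg q = ((F (σ.reg i) ∪ F (σ.reg j)).filter (fun v => v.val < w)).card)
    (by simp [State.setReg_reg, hq]) ?_
  · rw [h'.reg_four, Finset.filter_true_of_mem fun v _ => v.2] at this
    exact this
  · intro w τ hw h12 hτ hI
    rw [h'.reg_four] at hw
    have hτ' : Holds G s t F m τ := h'.of_agree hτ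
      (by simp only [Code.regs, List.mem_cons, List.not_mem_nil, or_false]; omega)
      (by simp [Code.arrs])
    have e1 : τ.reg i = σ.reg i := (hτ.1 i (by simp [Code.regs, hi12, hiq])).trans
      (by simp [State.setReg_reg, hiq])
    have e2 : τ.reg j = σ.reg j := (hτ.1 j (by simp [Code.regs, hj12, hjq])).trans
      (by simp [State.setReg_reg, hjq])
    have hsucc : (F (σ.reg i) ∪ F (σ.reg j)).filter (fun v => v.val < w + 1) =
        (F (σ.reg i) ∪ F (σ.reg j)).filter (fun v => v.val < w) ∪
          ((F (σ.reg i) ∪ F (σ.reg j)).filter (fun v => v = ⟨w, hw⟩)) := by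
      ext v
      simp only [Finset.mem_union, Finset.mem_filter, Fin.ext_iff, Nat.lt_succ_iff_lt_or_eq]
      tauto
    have hdis : Disjoint ((F (σ.reg i) ∪ F (σ.reg j)).filter (fun v => v.val < w))
        ((F (σ.reg i) ∪ F (σ.reg j)).filter (fun v => v = ⟨w, hw⟩)) := by
      rw [Finset.disjoint_filter]
      rintro v - h1 rfl
      exact lt_irrefl _ h1
    rw [hsucc, Finset.card_union_of_disjoint hdis, ← hI]
    simp only [Code.exec, State.setReg_reg, Expr.eval, if_neg hq.2.2.2.2, if_true]
    rw [hτ'.memExpr_eval (e1 ▸ hi) ⟨w, hw⟩ h12, hτ'.memExpr_eval (e2 ▸ hj) ⟨w, hw⟩ h12, e1, e2,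
      Finset.filter_eq']
    simp only [Finset.mem_union]
    by_cases h1 : (⟨w, hw⟩ : Fin n) ∈ F (σ.reg i) <;>
      by_cases h2 : (⟨w, hw⟩ : Fin n) ∈ F (σ.reg j) <;> simp [h1, h2]

/-- Reachability on `Fin n` as reachability on the numbers below `n`. -/
theorem reflTransGen_val_iff {R : Fin n → Fin n → Prop} {x y : Fin n} :
    Relation.ReflTransGen (fun u v : ℕ => ∃ x y : Fin n, x = u ∧ y = v ∧ R x y) x y ↔
      Relation.ReflTransGen R x y := by
  constructor
  · suffices H : ∀ v : ℕ, Relation.ReflTransGen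
        (fun u v : ℕ => ∃ x y : Fin n, x = u ∧ y = v ∧ R x y) x v →
        ∀ y : Fin n, y = v → Relation.ReflTransGen R x y from fun h => H _ h y rfl
    intro v h
    induction h with
    | refl =>
      intro y hy
      rw [Fin.ext hy]
    | tail _ h ih =>
      obtain ⟨a, b, rfl, rfl, hab⟩ := h
      intro y hy
      rw [Fin.ext hy]
      exact (ih a rfl).tail hab
  · intro h
    induction h with
    | refl => exact .refl
    | tail _ h ih => exact ih.tail ⟨_, _, rfl, rfl, h⟩

/-- A search from `s` that never enters the set decides whether `t` is reached. It does not test `s`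
itself, hence the separate test of `s`. The last conjunct protects the entries of earlier rows. -/
theorem Holds.validRow_exec (h : Holds G s t F m σ) (h6 : σ.reg 6 < m) (i : ℕ) :
    (IsSeparator G s t (F (σ.reg 6)) ∧ (F (σ.reg 6)).card ≤ σ.reg 3 →
        (validRow.exec σ).arr 6 (σ.reg 6) = 1) ∧
      (¬ (IsSeparator G s t (F (σ.reg 6)) ∧ (F (σ.reg 6)).card ≤ σ.reg 3) →
        (validRow.exec σ).arr 6 (σ.reg 6) = 0) ∧
      (i ≠ σ.reg 6 → (validRow.exec σ).arr 6 i = σ.arr 6 i) := by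
  classical
  have hclear := Code.exec_count (x := 9) (N := 4) (P := .store 7 (.reg 9) (.lit 0)) (σ := σ)
    (I := fun j τ => ∀ i < j, τ.arr 7 i = 0) (by simp) (by
      intro j τ _ h9 _ hI i hi
      simp only [Code.exec, State.setReg_arr, State.setArr_arr, Expr.eval, h9, true_and]
      split_ifs with hij
      · rfl
      · exact hI i (by omega))
  rw [h.reg_four] at hclear
  have hag₁ := (Code.count 9 4 (.store 7 (.reg 9) (.lit 0))).exec_agree σ
  set σ₁ := (Code.count 9 4 (.store 7 (.reg 9) (.lit 0))).exec σ with hσ₁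
  have hag₂ := (Code.store 7 (.reg 1) (.lit 1)).exec_agree σ₁
  have hstart : Marks 7 n {(s : ℕ)} ((Code.store 7 (.reg 1) (.lit 1)).exec σ₁) := by
    have h1 : σ₁.reg 1 = s := (hag₁.1 1 (by decide)).trans h.reg_one
    constructor
    all_goals
      intro i hi his
      rw [Set.mem_singleton_iff] at his
      simp only [Code.exec, State.setArr_arr, Expr.eval, h1, his, hclear i hi, and_true,
        and_false, if_true, if_false]
  set σ₂ := (Code.store 7 (.reg 1) (.lit 1)).exec σ₁ with hσ₂
  have h₂ : Holds G s t F m σ₂ :=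
    (h.of_agree hag₁ (by decide) (by decide)).of_agree hag₂ (by decide) (by decide)
  have e6₂ : σ₂.reg 6 = σ.reg 6 := (hag₂.1 6 (by decide)).trans (hag₁.1 6 (by decide))
  have hreach := reachCode_marks (a := 7) (N := 4) (m := n) (P := edgeCode) (σ := σ₂)
    (E := fun u v => ∃ x y : Fin n, x = u ∧ y = v ∧ (G.Adj x y ∧ y ∉ F (σ.reg 6)))
    (by decide) (by decide) (by decide) (by decide) h₂.reg_four
    (by rintro u v ⟨x, y, -, rfl, -⟩; exact y.2) (by
      intro τ hτ h10 h11
      have hτ' : Holds G s t F m τ := h₂.of_agree hτ (by decide) (by decide)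
      have e6 : τ.reg 6 = σ.reg 6 := (hτ.1 6 (by decide)).trans e6₂
      have hval : (edgeCode.exec τ).reg 13 =
          (if G.Adj ⟨τ.reg 10, h10⟩ ⟨τ.reg 11, h11⟩ then 1 else 0) -
            if (⟨τ.reg 11, h11⟩ : Fin n) ∈ F (σ.reg 6) then 1 else 0 := by
        rw [edgeCode, Code.exec, State.setReg_reg, if_pos rfl, Expr.eval,
          hτ'.memExpr_eval (e6 ▸ h6) ⟨τ.reg 11, h11⟩ rfl, e6, ← graphArray_apply]
        simp only [Expr.eval, hτ'.graph, hτ'.table _ (h10.trans_le h.le)]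
      rw [hval]
      constructor
      · rintro ⟨x, y, hx, hy, hxy, hyF⟩
        obtain rfl : x = ⟨τ.reg 10, h10⟩ := Fin.ext hx
        obtain rfl : y = ⟨τ.reg 11, h11⟩ := Fin.ext hy
        rw [if_pos hxy, if_neg hyF]
      · intro hno
        by_cases hadj : G.Adj ⟨τ.reg 10, h10⟩ ⟨τ.reg 11, h11⟩
        · by_cases hF : (⟨τ.reg 11, h11⟩ : Fin n) ∈ F (σ.reg 6)
          · rw [if_pos hadj, if_pos hF]
          · exact absurd ⟨_, _, rfl, rfl, hadj, hF⟩ hno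
        · rw [if_neg hadj, Nat.zero_sub]) s.2 hstart
  have hag₃ := (reachCode 7 4 edgeCode).exec_agree σ₂
  set σ₃ := (reachCode 7 4 edgeCode).exec σ₂ with hσ₃
  have h₃ : Holds G s t F m σ₃ := h₂.of_agree hag₃ (by decide) (by decide)
  have e6₃ : σ₃.reg 6 = σ.reg 6 := (hag₃.1 6 (by decide)).trans e6₂
  have hcard := h₃.unionCode_exec (i := 6) (j := 6) (q := 16) (e6₃ ▸ h6) (e6₃ ▸ h6) (by decide)
    (by decide) (by decide) (by decide) (by decide)
  have hag₄ := (unionCode 6 6 16).exec_agree σ₃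
  have heval : validRow.exec σ = ((unionCode 6 6 16).exec σ₃).setArr 6
      (((unionCode 6 6 16).exec σ₃).reg 6) _ := rfl
  set σ₄ := (unionCode 6 6 16).exec σ₃ with hσ₄
  have h₄ : Holds G s t F m σ₄ := h₃.of_agree hag₄ (by decide) (by decide)
  have e6₄ : σ₄.reg 6 = σ.reg 6 := (hag₄.1 6 (by decide)).trans e6₃
  have e3 : σ₄.reg 3 = σ.reg 3 := (hag₄.1 3 (by decide)).trans ((hag₃.1 3 (by decide)).trans
    ((hag₂.1 3 (by decide)).trans (hag₁.1 3 (by decide))))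
  have e7 : σ₄.arr 7 = σ₃.arr 7 := hag₄.2 7 (by decide)
  have e6a : σ₄.arr 6 = σ.arr 6 := (hag₄.2 6 (by decide)).trans ((hag₃.2 6 (by decide)).trans
    ((hag₂.2 6 (by decide)).trans (hag₁.2 6 (by decide))))
  have hsep : IsSeparator G s t (F (σ.reg 6)) ↔ s ∉ F (σ.reg 6) ∧ t ∉ F (σ.reg 6) ∧
      ¬ Relation.ReflTransGen
        (fun u v : ℕ => ∃ x y : Fin n, x = u ∧ y = v ∧ (G.Adj x y ∧ y ∉ F (σ.reg 6))) s t := by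
    rw [isSeparator_iff]
    refine and_congr_right fun hs => and_congr_right fun _ => not_congr ?_
    rw [reflTransGen_val_iff (R := fun x y => G.Adj x y ∧ y ∉ F (σ.reg 6))]
    exact linked_iff_reflTransGen hs
  rw [heval]
  simp only [State.setArr_arr, e6₄, true_and, if_true]
  have hms := h₄.memExpr_eval (i := 6) (e6₄ ▸ h6) s h₄.reg_one
  have hmt := h₄.memExpr_eval (i := 6) (e6₄ ▸ h6) t h₄.reg_two
  rw [e6₄] at hms hmt
  rw [Finset.union_self, e6₃] at hcard
  simp only [Expr.eval, hms, hmt, e7, h₄.reg_two, hcard, e3]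
  refine ⟨?_, ?_, ?_⟩
  · rintro ⟨hS, hK⟩
    obtain ⟨h1, h2, h3⟩ := hsep.1 hS
    rw [if_neg h1, if_neg h2, hreach.2 t t.2 h3, Nat.sub_eq_zero_of_le hK]
  · intro hno
    have hle : ∀ b c d e : ℕ, 1 ≤ b ∨ 1 ≤ c ∨ 1 ≤ d ∨ 1 ≤ e → 1 - (b + c + (d + e)) = 0 := by
      intros; omega
    apply hle
    by_cases h1 : s ∈ F (σ.reg 6)
    · exact .inl (by rw [if_pos h1])
    by_cases h2 : t ∈ F (σ.reg 6)
    · exact .inr (.inl (by rw [if_pos h2]))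
    by_cases h3 : Relation.ReflTransGen
        (fun u v : ℕ => ∃ x y : Fin n, x = u ∧ y = v ∧ (G.Adj x y ∧ y ∉ F (σ.reg 6))) s t
    · exact .inr (.inr (.inl (hreach.1 t t.2 h3).ge))
    · have : ¬ (F (σ.reg 6)).card ≤ σ.reg 3 := fun h4 => hno ⟨hsep.2 ⟨h1, h2, h3⟩, h4⟩
      exact .inr (.inr (.inr (by omega)))
  · intro hi
    rw [if_neg hi, e6a]

theorem Holds.validCode_exec (h : Holds G s t F m σ) {i : ℕ} (hi : i < m) :
    (IsSeparator G s t (F i) ∧ (F i).card ≤ σ.reg 3 → (validCode.exec σ).arr 6 i = 1) ∧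
      (¬ (IsSeparator G s t (F i) ∧ (F i).card ≤ σ.reg 3) → (validCode.exec σ).arr 6 i = 0) := by
  have := Code.exec_count (x := 6) (N := 5) (P := validRow) (σ := σ)
    (I := fun j τ => ∀ i < j,
      (IsSeparator G s t (F i) ∧ (F i).card ≤ σ.reg 3 → τ.arr 6 i = 1) ∧
        (¬ (IsSeparator G s t (F i) ∧ (F i).card ≤ σ.reg 3) → τ.arr 6 i = 0)) (by simp) ?_
  · exact this i (h.reg_five ▸ hi)
  · intro j τ hj h6 hτ hI i hi
    have hτ' : Holds G s t F m τ := h.of_agree hτ (by decide) (by decide)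
    have e3 : τ.reg 3 = σ.reg 3 := hτ.1 3 (by decide)
    obtain ⟨h1, h2, h3⟩ := hτ'.validRow_exec (h6 ▸ h.reg_five ▸ hj) i
    rw [h6, e3] at h1 h2
    rw [h6] at h3
    rw [State.setReg_arr]
    rcases Nat.lt_succ_iff_lt_or_eq.1 hi with hi | rfl
    · rw [h3 hi.ne]
      exact hI i hi
    · exact ⟨h1, h2⟩

theorem Holds.searchCode_exec (h : Holds G s t F m σ) {a b : ℕ} (ha : a < m) (hb : b < m)
    (h17 : σ.reg 17 = a) (h18 : σ.reg 18 = b) (h19 : σ.reg 19 = (F a ∪ F b).card)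
    (h20 : σ.reg 20 = (F a).card) (h21 : σ.reg 21 = (F b).card) (h8 : ∀ i, σ.arr 8 i = 0) :
    (F a = F b ∨ Relation.ReflTransGen (NodeAdj G s t F m (σ.reg 3) (σ.reg 14)) a b →
        (searchCode.exec σ).reg 0 = 1) ∧
      (¬ (F a = F b ∨ Relation.ReflTransGen (NodeAdj G s t F m (σ.reg 3) (σ.reg 14)) a b) →
        (searchCode.exec σ).reg 0 = 0) := by
  have hvalid := fun i (hi : i < m) => h.validCode_exec hi
  have hag₁ := validCode.exec_agree σ
  set σ₁ := validCode.exec σ with hσ₁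
  have hag₂ := (Code.store 8 (.reg 17) (.lit 1)).exec_agree σ₁
  have hstart : Marks 8 m {a} ((Code.store 8 (.reg 17) (.lit 1)).exec σ₁) := by
    have h1 : σ₁.reg 17 = a := (hag₁.1 17 (by decide)).trans h17
    have h2 : σ₁.arr 8 = σ.arr 8 := hag₁.2 8 (by decide)
    constructor
    all_goals
      intro i hi his
      rw [Set.mem_singleton_iff] at his
      simp only [Code.exec, State.setArr_arr, Expr.eval, h1, his, h2, h8 i, and_true,
        and_false, if_true, if_false]
  set σ₂ := (Code.store 8 (.reg 17) (.lit 1)).exec σ₁ with hσ₂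
  have h₂ : Holds G s t F m σ₂ :=
    (h.of_agree hag₁ (by decide) (by decide)).of_agree hag₂ (by decide) (by decide)
  have hreach := reachCode_marks (a := 8) (N := 5) (m := m) (P := nodeCode) (σ := σ₂)
    (E := NodeAdj G s t F m (σ.reg 3) (σ.reg 14))
    (by decide) (by decide) (by decide) (by decide) h₂.reg_five
    (fun u v huv => huv.2.1.1) (by
      intro τ hτ h10 h11
      have hτ' : Holds G s t F m τ := h₂.of_agree hτ (by decide) (by decide)
      have hcard := hτ'.unionCode_exec (i := 10) (j := 11) (q := 16) h10 h11 (by decide)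
        (by decide) (by decide) (by decide) (by decide)
      have hag := (unionCode 10 11 16).exec_agree τ
      have e6 : ((unionCode 10 11 16).exec τ).arr 6 = σ₁.arr 6 := (hag.2 6 (by decide)).trans
        ((hτ.2 6 (by decide)).trans (hag₂.2 6 (by decide)))
      have e14 : ((unionCode 10 11 16).exec τ).reg 14 = σ.reg 14 := (hag.1 14 (by decide)).trans
        ((hτ.1 14 (by decide)).trans ((hag₂.1 14 (by decide)).trans (hag₁.1 14 (by decide))))
      have e10 : ((unionCode 10 11 16).exec τ).reg 10 = τ.reg 10 := hag.1 10 (by decide)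
      have e11 : ((unionCode 10 11 16).exec τ).reg 11 = τ.reg 11 := hag.1 11 (by decide)
      -- The difference is 1 if both sets are valid and the excess of the union over the bound is
      -- zero; otherwise truncation gives 0.
      have hval : (nodeCode.exec τ).reg 13 = σ₁.arr 6 (τ.reg 10) + σ₁.arr 6 (τ.reg 11) - 1 -
          ((F (τ.reg 10) ∪ F (τ.reg 11)).card - σ.reg 14) := by
        rw [nodeCode, Code.exec, Code.exec, State.setReg_reg, if_pos rfl]
        simp only [Expr.eval, hcard, e6, e14, e10, e11]
      obtain ⟨u1, u0⟩ := hvalid _ h10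
      obtain ⟨v1, v0⟩ := hvalid _ h11
      rw [hval]
      constructor
      · rintro ⟨⟨-, hu⟩, ⟨-, hv⟩, hU⟩
        rw [u1 hu, v1 hv, Nat.sub_eq_zero_of_le hU]
      · intro hno
        by_cases hu : IsSeparator G s t (F (τ.reg 10)) ∧ (F (τ.reg 10)).card ≤ σ.reg 3
        · by_cases hv : IsSeparator G s t (F (τ.reg 11)) ∧ (F (τ.reg 11)).card ≤ σ.reg 3
          · have hU : ¬ (F (τ.reg 10) ∪ F (τ.reg 11)).card ≤ σ.reg 14 := fun hU =>
              hno ⟨⟨h10, hu⟩, ⟨h11, hv⟩, hU⟩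
            rw [u1 hu, v1 hv]
            omega
          · rw [u1 hu, v0 hv]
            omega
        · by_cases hv : IsSeparator G s t (F (τ.reg 11)) ∧ (F (τ.reg 11)).card ≤ σ.reg 3
          · rw [u0 hu, v1 hv]
            omega
          · rw [u0 hu, v0 hv]
            omega) ha hstart
  have hag₃ := (reachCode 8 5 nodeCode).exec_agree σ₂
  have heval : searchCode.exec σ = ((reachCode 8 5 nodeCode).exec σ₂).setReg 0 _ := rfl
  set σ₃ := (reachCode 8 5 nodeCode).exec σ₂ with hσ₃
  have e : ∀ r ∈ [18, 19, 20, 21], σ₃.reg r = σ.reg r := by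
    intro r hr
    have hr' : r ∉ (reachCode 8 5 nodeCode).regs ∧ r ∉ validCode.regs := by
      revert r
      decide
    exact (hag₃.1 r hr'.1).trans ((hag₂.1 r (by simp [Code.regs])).trans (hag₁.1 r hr'.2))
  rw [heval, State.setReg_reg, if_pos rfl]
  simp only [Expr.eval, e 18 (by decide), e 19 (by decide), e 20 (by decide), e 21 (by decide),
    h18, h19, h20, h21]
  have c1 := Finset.card_le_card (Finset.subset_union_left (s₁ := F a) (s₂ := F b))
  have c2 := Finset.card_le_card (Finset.subset_union_right (s₁ := F a) (s₂ := F b))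
  constructor
  · rintro (hF | hR)
    · rw [hF, Finset.union_self]
      omega
    · rw [hreach.1 b hb hR]
      omega
  · intro hno
    rw [not_or] at hno
    rw [hreach.2 b hb hno.2]
    -- A union as large as each of its two parts equals both of them.
    have hne : (F a ∪ F b).card ≠ (F a).card ∨ (F a ∪ F b).card ≠ (F b).card := by
      by_contra! hcon
      refine hno.1 ?_
      have e1 := Finset.eq_of_subset_of_card_le Finset.subset_union_left hcon.1.le
      have e2 := Finset.eq_of_subset_of_card_le Finset.subset_union_right hcon.2.le
      exact e1.trans e2.symm
    omega

end Correct

/-! ### The family of common neighborhoods and its construction -/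

theorem mul_add_lt {n x y : ℕ} (hx : x < n) (hy : y < n) : x * n + y < n * n :=
  calc x * n + y < (x + 1) * n := by rw [Nat.add_mul, Nat.one_mul]; omega
    _ ≤ n * n := Nat.mul_le_mul_right n hx

open Classical in
/-- The common neighborhoods of all pairs of vertices, followed by two further sets. -/
noncomputable def family {n : ℕ} (G : SimpleGraph (Fin n)) (S T : Finset (Fin n)) (i : ℕ) :
    Finset (Fin n) :=
  if i < n * n then
    Finset.univ.filter fun v => ∃ x y : Fin n, i = x * n + y ∧ G.Adj x v ∧ G.Adj y v
  else if i = n * n then S else T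

section Family

variable {n : ℕ} {G : SimpleGraph (Fin n)} {S T : Finset (Fin n)}

theorem mem_family_pair {x y v : Fin n} :
    v ∈ family G S T (x * n + y) ↔ G.Adj x v ∧ G.Adj y v := by
  rw [family, if_pos (mul_add_lt x.2 y.2)]
  simp only [Finset.mem_filter, Finset.mem_univ, true_and]
  constructor
  · rintro ⟨x', y', h, hadj⟩
    obtain ⟨h1, h2⟩ := mul_add_inj y.2 y'.2 h
    rwa [Fin.ext h1, Fin.ext h2]
  · exact fun h => ⟨x, y, rfl, h⟩

theorem family_source : family G S T (n * n) = S := by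
  simp [family]

theorem family_target : family G S T (n * n + 1) = T := by
  simp [family]

theorem exists_family_subset (hG : IsChordal G) {s t : Fin n} {U : Finset (Fin n)}
    (hU : IsSeparator G s t U) :
    ∃ i < n * n + 2, IsSeparator G s t (family G S T i) ∧ family G S T i ⊆ U := by
  obtain ⟨W, hWU, hW, x, y, hxy⟩ := hG.exists_commonNeighbors hU
  have : family G S T (x * n + y) = W := by
    ext v
    rw [mem_family_pair, hxy]
  exact ⟨x * n + y, (mul_add_lt x.2 y.2).trans (by omega), this ▸ hW, this ▸ hWU⟩

theorem setupCode_exec {σ : State} {s t : Fin n} (h1 : σ.reg 1 = s) (h2 : σ.reg 2 = t)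
    (h4 : σ.reg 4 = n) (h5 : σ.reg 5 = n * n + 2) (h0 : σ.arr 0 = graphArray G)
    (hS : σ.arr 1 = setArray S) (hT : σ.arr 2 = setArray T) :
    Holds G s t (family G S T) (n * n + 2) (setupCode.exec σ) ∧
      (setupCode.exec σ).reg 17 = n * n ∧ (setupCode.exec σ).reg 18 = n * n + 1 ∧
      (setupCode.exec σ).reg 19 = (S ∪ T).card ∧ (setupCode.exec σ).reg 20 = S.card ∧
      (setupCode.exec σ).reg 21 = T.card := by
  classical
  have hn : 0 < n := s.pos
  have hle : n ≤ n * n + 2 := (Nat.le_mul_self n).trans (Nat.le_add_right _ _)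
  have htable := fun i hi => tableCode_exec σ (i := i) hi
  have hag₁ := tableCode.exec_agree σ
  set σ₁ := tableCode.exec σ with hσ₁
  rw [h4, h5] at htable
  have e0 : σ₁.arr 0 = graphArray G := (hag₁.2 0 (by decide)).trans h0
  -- The membership matrix is stored row by row: cell `p` concerns vertex `p % n` and set `p / n`.
  have hfam := fun p hp => familyCode_exec (σ := σ₁) (n := n)
    (g := fun p => setArray (family G S T (p / n)) (p % n))
    ((hag₁.1 4 (by decide)).trans h4) (fun i hi => htable i (hi.trans_le hle)) (by
      intro x hx y hy w hw
      have d1 : ((x * n + y) * n + w) / n = x * n + y := by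
        rw [Nat.add_comm, Nat.add_mul_div_right _ _ hn, Nat.div_eq_of_lt hw, Nat.zero_add]
      have d2 : ((x * n + y) * n + w) % n = w := by
        rw [Nat.add_comm, Nat.add_mul_mod_self_right, Nat.mod_eq_of_lt hw]
      have f1 := setArray_apply (family G S T (x * n + y)) ⟨w, hw⟩
      have f2 := graphArray_apply G ⟨x, hx⟩ ⟨w, hw⟩
      have f3 := graphArray_apply G ⟨y, hy⟩ ⟨w, hw⟩
      have f4 := mem_family_pair (G := G) (S := S) (T := T) (x := ⟨x, hx⟩) (y := ⟨y, hy⟩)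
        (v := ⟨w, hw⟩)
      dsimp only at f1 f2 f3 f4 ⊢
      rw [d1, d2, e0, f1, f2, f3]
      by_cases a1 : G.Adj ⟨x, hx⟩ ⟨w, hw⟩ <;> by_cases a2 : G.Adj ⟨y, hy⟩ ⟨w, hw⟩ <;>
        simp [f4, a1, a2])
    (by
      intro w hw
      have d1 : (n * n * n + w) / n = n * n := by
        rw [Nat.add_comm, Nat.add_mul_div_right _ _ hn, Nat.div_eq_of_lt hw, Nat.zero_add]
      have d2 : (n * n * n + w) % n = w := by
        rw [Nat.add_comm, Nat.add_mul_mod_self_right, Nat.mod_eq_of_lt hw]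
      rw [d1, d2, family_source, hag₁.2 1 (by decide), hS])
    (by
      intro w hw
      have d1 : ((n * n + 1) * n + w) / n = n * n + 1 := by
        rw [Nat.add_comm, Nat.add_mul_div_right _ _ hn, Nat.div_eq_of_lt hw, Nat.zero_add]
      have d2 : ((n * n + 1) * n + w) % n = w := by
        rw [Nat.add_comm, Nat.add_mul_mod_self_right, Nat.mod_eq_of_lt hw]
      rw [d1, d2, family_target, hag₁.2 2 (by decide), hT]) (p := p) hp
  have hag₂ := familyCode.exec_agree σ₁
  have heval : setupCode.exec σ = (unionCode 18 18 21).exec ((unionCode 17 17 20).exec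
      ((unionCode 17 18 19).exec ((Code.assign 18 (.sub (.reg 5) (.lit 1))).exec
        ((Code.assign 17 (.sub (.reg 5) (.lit 2))).exec (familyCode.exec σ₁))))) := rfl
  set σ₂ := familyCode.exec σ₁ with hσ₂
  have e : ∀ r ∈ [1, 2, 4, 5], σ₂.reg r = σ.reg r := by
    intro r hr
    have hr' : r ∉ familyCode.regs ∧ r ∉ tableCode.regs := by
      revert r
      decide
    exact (hag₂.1 r hr'.1).trans (hag₁.1 r hr'.2)
  have hH₂ : Holds G s t (family G S T) (n * n + 2) σ₂ := by
    refine ⟨hle, (e 1 (by decide)).trans h1, (e 2 (by decide)).trans h2,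
      (e 4 (by decide)).trans h4, (e 5 (by decide)).trans h5, (hag₂.2 0 (by decide)).trans e0,
      fun i hi => ?_, fun i hi v => ?_⟩
    · rw [hag₂.2 3 (by decide)]
      exact htable i hi
    · have hlt : i * n + v < (n * n + 2) * n :=
        calc i * n + (v : ℕ) < (i + 1) * n := by rw [Nat.add_mul, Nat.one_mul]; omega
          _ ≤ (n * n + 2) * n := Nat.mul_le_mul_right n hi
      rw [hfam _ hlt, Nat.add_comm, Nat.add_mul_div_right _ _ hn, Nat.div_eq_of_lt v.2,
        Nat.zero_add, Nat.add_mul_mod_self_right, Nat.mod_eq_of_lt v.2]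
  have r17 : ((Code.assign 17 (.sub (.reg 5) (.lit 2))).exec σ₂).reg 17 = n * n := by
    simp [Code.exec, State.setReg_reg, Expr.eval, hH₂.reg_five]
  have hag₃ := (Code.assign 17 (.sub (.reg 5) (.lit 2))).exec_agree σ₂
  set σ₃ := (Code.assign 17 (.sub (.reg 5) (.lit 2))).exec σ₂ with hσ₃
  have hH₃ := hH₂.of_agree hag₃ (by decide) (by decide)
  have r18 : ((Code.assign 18 (.sub (.reg 5) (.lit 1))).exec σ₃).reg 18 = n * n + 1 := by
    simp [Code.exec, State.setReg_reg, Expr.eval, hH₃.reg_five]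
  have hag₄ := (Code.assign 18 (.sub (.reg 5) (.lit 1))).exec_agree σ₃
  set σ₄ := (Code.assign 18 (.sub (.reg 5) (.lit 1))).exec σ₃ with hσ₄
  have hH₄ := hH₃.of_agree hag₄ (by decide) (by decide)
  rw [← hag₄.1 17 (by decide)] at r17
  have r19 := hH₄.unionCode_exec (i := 17) (j := 18) (q := 19) (by omega) (by omega) (by decide)
    (by decide) (by decide) (by decide) (by decide)
  rw [r17, r18, family_source, family_target] at r19
  have hag₅ := (unionCode 17 18 19).exec_agree σ₄
  set σ₅ := (unionCode 17 18 19).exec σ₄ with hσ₅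
  have hH₅ := hH₄.of_agree hag₅ (by decide) (by decide)
  rw [← hag₅.1 17 (by decide)] at r17
  rw [← hag₅.1 18 (by decide)] at r18
  have r20 := hH₅.unionCode_exec (i := 17) (j := 17) (q := 20) (by omega) (by omega) (by decide)
    (by decide) (by decide) (by decide) (by decide)
  rw [r17, family_source, Finset.union_self] at r20
  have hag₆ := (unionCode 17 17 20).exec_agree σ₅
  set σ₆ := (unionCode 17 17 20).exec σ₅ with hσ₆
  have hH₆ := hH₅.of_agree hag₆ (by decide) (by decide)
  rw [← hag₆.1 17 (by decide)] at r17
  rw [← hag₆.1 18 (by decide)] at r18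
  rw [← hag₆.1 19 (by decide)] at r19
  have r21 := hH₆.unionCode_exec (i := 18) (j := 18) (q := 21) (by omega) (by omega) (by decide)
    (by decide) (by decide) (by decide) (by decide)
  rw [r18, family_target, Finset.union_self] at r21
  have hag₇ := (unionCode 18 18 21).exec_agree σ₆
  rw [heval]
  exact ⟨hH₆.of_agree hag₇ (by decide) (by decide), (hag₇.1 17 (by decide)).trans r17,
    (hag₇.1 18 (by decide)).trans r18, (hag₇.1 19 (by decide)).trans r19,
    (hag₇.1 20 (by decide)).trans r20, r21⟩

end Family

/-- Reachability in the family of common neighborhoods is decidable in polynomial time, where the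
bounds for the sizes are computed by the program `P`. -/
theorem solvableInPolyTime_of_family {ι : Type} (inst : ι → Instance) (k K M : ι → ℕ)
    {yes : ι → Prop} {P : Code} (hreg : P.regs ⊆ [3, 14]) (harr : P.arrs = [])
    (hbounds : P.bounds = []) (hcounted : P.Counted)
    (hP : ∀ i τ, τ.reg 3 = k i → τ.reg 20 = (inst i).source.card →
      τ.reg 21 = (inst i).target.card → (P.exec τ).reg 3 = K i ∧ (P.exec τ).reg 14 = M i)
    (hyes : ∀ i, yes i ↔ (inst i).source = (inst i).target ∨
      Relation.ReflTransGen (NodeAdj (inst i).graph (inst i).s (inst i).t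
        (family (inst i).graph (inst i).source (inst i).target)
        ((inst i).n * (inst i).n + 2) (K i) (M i))
        ((inst i).n * (inst i).n) ((inst i).n * (inst i).n + 1)) :
    SolvableInPolyTime (fun i => (inst i).n) (fun i => (inst i).input (k i)) yes := by
  classical
  have hmem : ∀ r ∈ P.regs, r = 3 ∨ r = 14 := fun r hr => by simpa using hreg hr
  have hout : ∀ r, r ≠ 3 → r ≠ 14 → r ∉ P.regs := fun r h3 h14 hr =>
    (hmem r hr).elim h3 h14
  -- `runs_compile` reads the loop bounds in the initial memory, but registers 4 and 5 are only set
  -- by `sizeCode`. So the two parts are timed separately, with bounds `n` and `n * n + 2`.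
  refine ⟨.seq sizeCode.compile (Code.seq setupCode (.seq P searchCode)).compile,
    sizeCode.costPoly + (Code.seq setupCode (.seq P searchCode)).costPoly.comp (.X * .X + .C 2),
    fun i => ?_⟩
  set I := inst i with hI
  set σ := I.input (k i) with hσ
  obtain ⟨c, hc, hcB⟩ := sizeCode.runs_compile (by simp [sizeCode, Code.Counted, Code.regs])
    (σ := σ) (B := I.n) (by
      intro N hN
      have : N = 0 := by simpa [sizeCode, Code.bounds] using hN
      subst this
      exact ⟨by decide, le_rfl⟩)
  obtain ⟨h4, h5⟩ := sizeCode_exec σ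
  have hag := sizeCode.exec_agree σ
  set σ₁ := sizeCode.exec σ with hσ₁
  have h4 : σ₁.reg 4 = I.n := h4
  have h5 : σ₁.reg 5 = I.n * I.n + 2 := h5
  have hsc : setupCode.Counted ∧ searchCode.Counted := by
    refine ⟨?_, ?_⟩ <;>
    simp [setupCode, searchCode, tableCode, familyCode, unionCode, rowCode, validCode, validRow,
      reachCode, reachRound, edgeCode, nodeCode, Code.Counted, Code.regs]
  obtain ⟨d, hd, hdB⟩ := (Code.seq setupCode (.seq P searchCode)).runs_compile
    ⟨hsc.1, hcounted, hsc.2⟩ (σ := σ₁) (B := I.n * I.n + 2) (by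
      intro N hN
      have hN' : N = 4 ∨ N = 5 := by
        have hb : ∀ N ∈ setupCode.bounds ++ searchCode.bounds, N = 4 ∨ N = 5 := by decide
        refine hb N ?_
        simpa [Code.bounds, hbounds] using hN
      have hnot : ∀ r, r = 4 ∨ r = 5 → r ∉ setupCode.regs ∧ r ∉ searchCode.regs := by
        rintro r (rfl | rfl) <;> decide
      refine ⟨?_, ?_⟩
      · have := hout N (by omega) (by omega)
        simp only [Code.regs, List.mem_append, not_or]
        exact ⟨(hnot N hN').1, this, (hnot N hN').2⟩
      · have := Nat.le_mul_self I.n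
        rcases hN' with rfl | rfl <;> omega)
  obtain ⟨hH, h17, h18, h19, h20, h21⟩ := setupCode_exec (σ := σ₁) (G := I.graph) (s := I.s)
    (t := I.t) (S := I.source) (T := I.target) (hag.1 1 (by decide)) (hag.1 2 (by decide)) h4 h5
    (hag.2 0 (by decide)) (hag.2 1 (by decide)) (hag.2 2 (by decide))
  have hag₂ := setupCode.exec_agree σ₁
  set σ₂ := setupCode.exec σ₁ with hσ₂
  obtain ⟨h3, h14⟩ := hP i σ₂
    ((hag₂.1 3 (by decide)).trans (hag.1 3 (by decide))) h20 h21
  have hag₃ := P.exec_agree σ₂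
  have heval : (Code.seq setupCode (.seq P searchCode)).exec σ₁ = searchCode.exec (P.exec σ₂) := rfl
  set σ₃ := P.exec σ₂ with hσ₃
  have hH₃ := hH.of_agree hag₃ ⟨hout 1 (by decide) (by decide), hout 2 (by decide) (by decide),
    hout 4 (by decide) (by decide), hout 5 (by decide) (by decide)⟩ (by simp [harr])
  have e : ∀ r, r ≠ 3 → r ≠ 14 → σ₃.reg r = σ₂.reg r := fun r h h' => hag₃.1 r (hout r h h')
  obtain ⟨hy, hno⟩ := hH₃.searchCode_exec (a := I.n * I.n) (b := I.n * I.n + 1) (by omega)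
    (by omega) ((e 17 (by decide) (by decide)).trans h17)
    ((e 18 (by decide) (by decide)).trans h18)
    (by rw [family_source, family_target]; exact (e 19 (by decide) (by decide)).trans h19)
    (by rw [family_source]; exact (e 20 (by decide) (by decide)).trans h20)
    (by rw [family_target]; exact (e 21 (by decide) (by decide)).trans h21)
    (fun j => by
      rw [hag₃.2 8 (by simp [harr]), hag₂.2 8 (by decide), hag.2 8 (by decide)]
      rfl)
  rw [family_source, family_target, h3, h14, ← hyes i, ← heval] at hy hno
  refine ⟨_, c + d, .seq hc hd, ?_, ?_⟩
  · simp only [Polynomial.eval_add, Polynomial.eval_comp, Polynomial.eval_mul, Polynomial.eval_X,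
      Polynomial.eval_C]
    exact Nat.add_le_add hcB hdB
  · by_cases h : yes i
    · exact .inl ⟨h, hy h⟩
    · exact .inr ⟨h, hno h⟩

/-! ### The two rules -/

theorem Instance.tar_iff (I : Instance) (hG : IsChordal I.graph) (k : ℕ) :
    I.TAR k ↔ I.source = I.target ∨ Relation.ReflTransGen (NodeAdj I.graph I.s I.t
      (family I.graph I.source I.target) (I.n * I.n + 2) k k) (I.n * I.n) (I.n * I.n + 1) := by
  have := reconfigurable_tar_iff (G := I.graph) (s := I.s) (t := I.t)
    (F := family I.graph I.source I.target) (m := I.n * I.n + 2) (k := k) (a := I.n * I.n)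
    (b := I.n * I.n + 1) (fun S hS => exists_family_subset hG hS) (by omega) (by omega)
    (by rw [family_source]; exact I.source_sep)
  rwa [family_source, family_target] at this

theorem Instance.tj_iff (I : Instance) (hG : IsChordal I.graph) :
    I.TJ ↔ I.source = I.target ∨ Relation.ReflTransGen (NodeAdj I.graph I.s I.t
      (family I.graph I.source I.target) (I.n * I.n + 2) (min I.source.card I.target.card)
      (min I.source.card I.target.card + 1)) (I.n * I.n) (I.n * I.n + 1) := by
  have := reconfigurable_tj_iff (G := I.graph) (s := I.s) (t := I.t)
    (F := family I.graph I.source I.target) (m := I.n * I.n + 2) (a := I.n * I.n)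
    (b := I.n * I.n + 1) (fun S hS => exists_family_subset hG hS) (by omega) (by omega)
    (by rw [family_source]; exact I.source_sep) (by rw [family_target]; exact I.target_sep)
  rwa [family_source, family_target] at this

end VSR

theorem mainTheorem10 :
    VSR.SolvableInPolyTime
        (fun I : VSR.ChordalInstance => I.1.n)
        (fun I : VSR.ChordalInstance => I.1.input 0)
        (fun I : VSR.ChordalInstance => I.1.TJ) ∧
      VSR.SolvableInPolyTime
        (fun I : VSR.ChordalInstance × ℕ => I.1.1.n)
        (fun I : VSR.ChordalInstance × ℕ => I.1.1.input I.2)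
        (fun I : VSR.ChordalInstance × ℕ => I.1.1.TAR I.2) := by
  constructor
  · refine VSR.solvableInPolyTime_of_family (fun I : VSR.ChordalInstance => I.1) (fun _ => 0)
      (fun I => min I.1.source.card I.1.target.card)
      (fun I => min I.1.source.card I.1.target.card + 1)
      -- With truncated subtraction `a - (a - b)` is the minimum of `a` and `b`.
      (P := .seq (.assign 3 (.sub (.reg 20) (.sub (.reg 20) (.reg 21))))
        (.assign 14 (.add (.reg 3) (.lit 1))))
      (by decide) rfl rfl ⟨trivial, trivial⟩ ?_ fun I => I.1.tj_iff I.2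
    intro I τ _ h20 h21
    simp only [VSR.Code.exec, VSR.State.setReg_reg, VSR.Expr.eval, h20, h21]
    simp
    omega
  -- Register 3 already holds `k`, which is the bound both for the sets and for their unions.
  · refine VSR.solvableInPolyTime_of_family (fun I : VSR.ChordalInstance × ℕ => I.1.1)
      (fun I => I.2) (fun I => I.2) (fun I => I.2) (P := .assign 14 (.reg 3))
      (by decide) rfl rfl trivial ?_ fun I => I.1.1.tar_iff I.1.2 I.2
    intro I τ h3 _ _
    simp [VSR.Code.exec, VSR.State.setReg_reg, VSR.Expr.eval, h3]
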